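/- **Setting.** Fix real parameters $\alpha,\beta,\kappa$ and consider the string of second-order subsystems indexed by $k\in\mathbb Z$, with $t=0,1,2,\dots$ and zero initial state, $$x^1_{k,t+1}=\beta x^1_{k,t}+x^2_{k,t}+w^{x,1}_{k,t},\qquad x^2_{k,t+1}=\alpha\big(x^2_{k,t}+\kappa(x^2_{k-1,t}+x^2_{k+1,t})\big)+w^{x,2}_{k,t}+w^u_{k,t}+u_{k,t},$$ $$y_{k,t}=x^1_{k,t}+w^y_{k,t},\qquad \zeta_{k,t}=(x^1_{k,t},x^2_{k,t},u_{k,t})^T,$$ under causal, linear, time- and space-invariant real output feedback $u_{k,t}=\sum_{\tau\le t}\sum_{j\in\mathbb Z}K_{k-j,t-\tau}\,y_{j,\tau}$ with $\sum_k|K_{k,t}|<\infty$ for each $t$. Let $R,M,N,L$ be the closed-loop maps given by $x=Rw^x+Nw^y$, $u=Mw^x+Lw^y$, and let $\mathcal F(P,K)$ be the closed-loop map from $(w^y,w^u)$ to $\zeta$; each map is identified with its spatio-temporal impulse response $G_{k,t}$. Scalar $\mathcal{RH}_\infty$ is the set of proper rational functions of $z$ with all poles in the open unit disk (real coefficients for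 functions attached to a site $k$, complex ones at a fixed spatial frequency). A spatially invariant map is in $\mathcal{RH}_\infty$ if for every $\theta$ each entry of $\sum_t\sum_k G_{k,t}e^{-ik\theta}z^{-t}$ is. $K$ is internally stabilizing if all closed-loop maps from $w^x,w^u,w^y$ to $x,u,y$ are in $\mathcal{RH}_\infty$. A map has extent at most $E$ if $G_{k,\cdot}=0$ for $|k|>E$, and finite extent if this holds for some $E$. Put $\|G\|_2^2=\sum_k\sum_t\operatorname{tr}(G_{k,t}^TG_{k,t})$; for a column of transfer functions $\|v\|_2^2$ is the sum of the squares of all coefficients of the expansions in powers of $z^{-1}$. **Model-matching data.** For $E\ge 0$, let $T$ be the tridiagonal Toeplitz matrix with $z-\alpha$ on the diagonal and $-\alpha\kappa$ on the two neighbouring diagonals, and $Q$ the pentadiagonal Toeplitz matrix with $(z-\alpha)^2+2(\alpha\kappa)^2$ on the diagonal, $-2\alpha\kappa(z-\alpha)$ at distance $1$ and $(\alpha\kappa)^2$ at distance $2$; the entry in row $i$ and column $j$ depends on $i-j$, columns are indexed by $-(E+1),\dots,E+1$, and the rows of the block of $q$ by $-E_q,\dots,E_q$. With $\delta_k=1$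 for $k=0$ and $0$ otherwise, set - $q=n^1$ and $q=m^2$ ($E_q=E+2$): $V^q=(z-\beta)T$, $h^q_k=-\delta_k$; - $q=n^2$ ($E_q=E+2$): $V^q=(z-\beta)^2T$, $h^q_k=-(z-\beta)\delta_k$; - $q=r^{12}$ ($E_q=E+1$): $V^q=I$, $h^q=0$; - $q=r^{22}$ ($E_q=E+1$): $V^q=(z-\beta)I$, $h^q=0$; - $q=\ell$ ($E_q=E+3$): $V^q=(z-\beta)^2Q$, $h^q_k=(z-\beta)\big((\alpha-z)\delta_k+\alpha\kappa(\delta_{k-1}+\delta_{k+1})\big)$. Let $V$ and $h$ be the stacks of the $V^q$ and the $h^q$ in the order $n^1,r^{12},n^2,r^{22},\ell,m^2$, and $$S=z^{-4}\begin{bmatrix}0\\ I_{2E+1}\\ 0\end{bmatrix},\qquad g_k=z^{-3}\big((z+\alpha+\beta)\delta_k+\alpha\kappa(\delta_{k-1}+\delta_{k+1})\big),\qquad V^{\rm SL}_E=VS,\qquad h^{\rm SL}_E=Vg+h.$$ For a controller $K$ define its parameter $f=(f_k)_{k\in\mathbb Z}$ by $r^{12}_k=g_k+z^{-4}f_k$,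 where $r^{12}$ is the $(1,2)$ entry of $R$; at spatial frequency $\theta$ this reads $r^{12}=z^{-2}+z^{-3}(\sigma+\beta)+z^{-4}f$ with $\sigma=\alpha(1+2\kappa\cos\theta)$. Call $K$ *feasible* if it is internally stabilizing and $R,M,N,L$ all have finite extent, and *$E$-feasible* if, moreover, its parameter $f$ has extent at most $E$. **Theorem.** The problem $\inf\|\mathcal F(P,K)\|_2$ over feasible $K$ is equivalent to the unconstrained convex problems $\inf_{f\in\mathcal{RH}_\infty^{2E+1}}\|V^{\rm SL}_Ef+h^{\rm SL}_E\|_2^2$ in the following sense. 1. $K$ is feasible if and only if it is $E$-feasible for some $E$, and $$\Big(\inf_{K\text{ feasible}}\|\mathcal F(P,K)\|_2\Big)^2=\inf_{E\ge0}\ \inf_{f\in\mathcal{RH}_\infty^{2E+1}}\|V^{\rm SL}_Ef+h^{\rm SL}_E\|_2^2 .$$ 2. For every $E\ge 0$, the map $K\mapsto(f_k)_{|k|\le E}$ is a bijection from the $E$-feasible controllers onto $\mathcal{RH}_\infty^{2E+1}$; it satisfies $\|\mathcal F(P,K)\|_2^2=\|V^{\rm SL}_Ef+h^{\rm SL}_E\|_2^2$,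 and hence $$\Big(\inf_{K\ E\text{-feasible}}\|\mathcal F(P,K)\|_2\Big)^2=\inf_{f\in\mathcal{RH}_\infty^{2E+1}}\|V^{\rm SL}_Ef+h^{\rm SL}_E\|_2^2 .$$ 3. For an $E$-feasible $K$, $R$ and $N$ have extent at most $\max\{E+1,2\}$, and $M$ and $L$ have extent at most $\max\{E+2,3\}$. If $E\ge1$ and $\alpha\kappa\ne0$, then $K$ is $E$-feasible if and only if it is internally stabilizing, $R,N$ have extent at most $E+1$, and $M,L$ have extent at most $E+2$. 4. For every $E\ge0$ the cost $f\mapsto\|V^{\rm SL}_Ef+h^{\rm SL}_E\|_2^2$ is finite and convex on $\mathcal{RH}_\infty^{2E+1}$. -/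

import Mathlib

open scoped ENNReal

noncomputable section

namespace SpatialSL

/-! ### Transfer functions

A transfer function is represented by its expansion in powers of `z⁻¹`, i.e. by a Laurent series
whose formal variable stands for `z⁻¹`; the coefficient of index `t` is the value of the impulse
response at time `t`. -/

/-- The temporal frequency variable `z`. -/
def zVar (𝕜 : Type*) [Field 𝕜] : LaurentSeries 𝕜 := HahnSeries.single (-1 : ℤ) (1 : 𝕜)

/-- The temporal transform `∑ₜ gₜ z⁻ᵗ` of a causal sequence. -/
def zTransform {𝕜 : Type*} [Field 𝕜] (g : ℕ → 𝕜) : LaurentSeries 𝕜 :=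
  HahnSeries.ofPowerSeries ℤ 𝕜 (PowerSeries.mk g)

/-- Scalar `RH∞`: the causal (proper), stable, rational transfer functions `N(z) / D(z)`, where
stable means that all zeros of `D` lie in the open unit disk. -/
def RHinf (𝕜 : Type*) [Field 𝕜] [Algebra 𝕜 ℂ] : Set (LaurentSeries 𝕜) :=
  {G | ∃ N D : Polynomial 𝕜, N.degree ≤ D.degree ∧
      (∀ s : ℂ, Polynomial.aeval s D = 0 → ‖s‖ < 1) ∧
      Polynomial.aeval (zVar 𝕜) D * G = Polynomial.aeval (zVar 𝕜) N}

/-! ### Spatially invariant systems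

A scalar causal LTSI system is given by its spatio-temporal impulse response `G k t`, with spatial
index `k : ℤ` and time `t : ℕ`. -/

/-- The spatial Fourier transform `∑ₖ G k t e^{-ikθ}`, for each time `t`. -/
def spatialTransform (G : ℤ → ℕ → ℝ) (θ : ℝ) (t : ℕ) : ℂ :=
  ∑' k : ℤ, (G k t : ℂ) * Complex.exp (-(Complex.I * k * θ))

/-- A scalar LTSI system is in `RH∞` if its transfer function is causal, stable and rational at
every spatial frequency. -/
def IsRHinf (G : ℤ → ℕ → ℝ) : Prop :=
  (∀ t, Summable fun k => G k t) ∧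
    ∀ θ : ℝ, zTransform (spatialTransform G θ) ∈ RHinf ℂ

/-- `G` has extent `E`: site `i` is not influenced by site `j` when `|i - j| > E`. -/
def HasExtent {X : Type*} [Zero X] (E : ℕ) (G : ℤ → X) : Prop :=
  ∀ k : ℤ, (E : ℤ) < |k| → G k = 0

/-- `ext(G) < ∞`. -/
def FiniteExtent {X : Type*} [Zero X] (G : ℤ → X) : Prop :=
  ∃ E : ℕ, HasExtent E G

/-- The squared 2-norm `∑ₖ ∑ₜ trace (Gₖₜᵀ Gₖₜ)` of a matrix-valued LTSI system. -/
def systemNormSq {m n : Type*} [Fintype m] [Fintype n] (G : ℤ → ℕ → Matrix m n ℝ) : ℝ≥0∞ :=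
  ∑' k : ℤ, ∑' t : ℕ, ENNReal.ofReal ((G k t).transpose * G k t).trace

/-- The 2-norm of a matrix-valued LTSI system. -/
def systemNorm {m n : Type*} [Fintype m] [Fintype n] (G : ℤ → ℕ → Matrix m n ℝ) : ℝ≥0∞ :=
  systemNormSq G ^ (1 / 2 : ℝ)

/-- The squared 2-norm of a finite column of transfer functions: the sum of the squares of all
the coefficients of the expansions in powers of `z⁻¹`. -/
def columnNormSq {ι : Type*} [Fintype ι] (v : ι → LaurentSeries ℝ) : ℝ≥0∞ :=
  ∑ i, ∑' t : ℤ, ENNReal.ofReal ((v i).coeff t ^ 2)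

/-! ### The plant and the feedback loop -/

/-- A causal LTSI output feedback controller `u = K y`, given by its impulse response. Spatial
summability at each time makes the convolution and the spatial transform meaningful. -/
@[ext]
structure Controller where
  ker : ℤ → ℕ → ℝ
  summable : ∀ t, Summable fun k => ker k t

/-- The places where a disturbance enters the loop: the two state equations (`w^{x}`), the
control input (`w^u`) and the measurement (`w^y`). -/
inductive Dist
  | x1 | x2 | u | y
  deriving DecidableEq

/-- The signals of the loop. -/
inductive Signal
  | x1 | x2 | u | y

/-- The state `(x¹ₖ, x²ₖ)` at time `t` of the closed loop, started at rest, with disturbances `w`: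
* `x¹ₖ(t+1) = β x¹ₖ(t) + x²ₖ(t) + w^{x,1}ₖ(t)`,
* `x²ₖ(t+1) = α (x²ₖ(t) + κ (x²ₖ₋₁(t) + x²ₖ₊₁(t))) + w^{x,2}ₖ(t) + w^uₖ(t) + uₖ(t)`,
* `yₖ(t) = x¹ₖ(t) + w^yₖ(t)`,
* `uₖ(t) = ∑_{τ ≤ t} ∑ⱼ K_{k-j}(t-τ) yⱼ(τ)`. -/
def state (α β κ : ℝ) (K : Controller) (w : Dist → ℤ → ℕ → ℝ) : ℕ → ℤ → ℝ × ℝ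
  | 0 => fun _ => (0, 0)
  | t + 1 => fun k =>
      (β * (state α β κ K w t k).1 + (state α β κ K w t k).2 + w .x1 k t,
       α * ((state α β κ K w t k).2
          + κ * ((state α β κ K w t (k - 1)).2 + (state α β κ K w t (k + 1)).2))
        + w .x2 k t + w .u k t
        + ∑ τ : Fin (t + 1), ∑' j : ℤ,
            K.ker (k - j) (t - τ) * ((state α β κ K w τ j).1 + w .y j τ))
  termination_by t => t
  decreasing_by all_goals omega

/-- The measurement `y` in the closed loop. -/
def measurement (α β κ : ℝ) (K : Controller) (w : Dist → ℤ → ℕ → ℝ) (k : ℤ) (t : ℕ) : ℝ :=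
  (state α β κ K w t k).1 + w .y k t

/-- The control `u = K y` in the closed loop. -/
def control (α β κ : ℝ) (K : Controller) (w : Dist → ℤ → ℕ → ℝ) (k : ℤ) (t : ℕ) : ℝ :=
  ∑ τ : Fin (t + 1), ∑' j : ℤ, K.ker (k - j) (t - τ) * measurement α β κ K w j τ

theorem state_zero (α β κ : ℝ) (K : Controller) (w : Dist → ℤ → ℕ → ℝ) (k : ℤ) :
    state α β κ K w 0 k = (0, 0) := by
  rw [state]

theorem state_succ (α β κ : ℝ) (K : Controller) (w : Dist → ℤ → ℕ → ℝ) (k : ℤ) (t : ℕ) :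
    state α β κ K w (t + 1) k =
      (β * (state α β κ K w t k).1 + (state α β κ K w t k).2 + w .x1 k t,
       α * ((state α β κ K w t k).2
          + κ * ((state α β κ K w t (k - 1)).2 + (state α β κ K w t (k + 1)).2))
        + w .x2 k t + w .u k t + control α β κ K w k t) := by
  rw [state]
  rfl

/-- The unit impulse at site `0` and time `0` in channel `c`. -/
def impulse (c : Dist) : Dist → ℤ → ℕ → ℝ :=
  fun c' k t => if c' = c ∧ k = 0 ∧ t = 0 then 1 else 0

/-- The impulse response of the closed-loop map from the disturbance channel `c` to a signal. -/
def response (α β κ : ℝ) (K : Controller) (c : Dist) : Signal → ℤ → ℕ → ℝ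
  | .x1 => fun k t => (state α β κ K (impulse c) t k).1
  | .x2 => fun k t => (state α β κ K (impulse c) t k).2
  | .u => control α β κ K (impulse c)
  | .y => measurement α β κ K (impulse c)

/-- The closed-loop map `R` from `w^x` to `x`. -/
def slR (α β κ : ℝ) (K : Controller) (k : ℤ) (t : ℕ) : Matrix (Fin 2) (Fin 2) ℝ :=
  !![response α β κ K .x1 .x1 k t, response α β κ K .x2 .x1 k t;
     response α β κ K .x1 .x2 k t, response α β κ K .x2 .x2 k t]

/-- The closed-loop map `M` from `w^x` to `u`. -/
def slM (α β κ : ℝ) (K : Controller) (k : ℤ) (t : ℕ) : Matrix (Fin 1) (Fin 2) ℝ :=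
  !![response α β κ K .x1 .u k t, response α β κ K .x2 .u k t]

/-- The closed-loop map `N` from `w^y` to `x`. -/
def slN (α β κ : ℝ) (K : Controller) (k : ℤ) (t : ℕ) : Matrix (Fin 2) (Fin 1) ℝ :=
  !![response α β κ K .y .x1 k t; response α β κ K .y .x2 k t]

/-- The closed-loop map `L` from `w^y` to `u`. -/
def slL (α β κ : ℝ) (K : Controller) (k : ℤ) (t : ℕ) : Matrix (Fin 1) (Fin 1) ℝ :=
  !![response α β κ K .y .u k t]

/-- The closed-loop map `F(P, K)` from `w = (w^y, w^u)` to the regulated output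
`ζ = (x¹, x², u)`. -/
def closedLoop (α β κ : ℝ) (K : Controller) (k : ℤ) (t : ℕ) : Matrix (Fin 3) (Fin 2) ℝ :=
  !![response α β κ K .y .x1 k t, response α β κ K .u .x1 k t;
     response α β κ K .y .x2 k t, response α β κ K .u .x2 k t;
     response α β κ K .y .u k t, response α β κ K .u .u k t]

/-- Internal stability: every map from a disturbance entering the loop to a signal of the loop
is in `RH∞`. -/
def InternallyStabilizing (α β κ : ℝ) (K : Controller) : Prop :=
  ∀ (c : Dist) (s : Signal), IsRHinf (response α β κ K c s)

/-- The feasible controllers of the constrained problem: internally stabilizing, and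
`R`, `M`, `N`, `L` all have finite extent. -/
def SLFeasible (α β κ : ℝ) (K : Controller) : Prop :=
  InternallyStabilizing α β κ K ∧
    FiniteExtent (slR α β κ K) ∧ FiniteExtent (slM α β κ K) ∧
    FiniteExtent (slN α β κ K) ∧ FiniteExtent (slL α β κ K)

/-- Quantitative extent bounds on the four maps: `a` for `R`, `N` and `b` for `M`, `L`. -/
def SLExtentBounds (α β κ : ℝ) (a b : ℕ) (K : Controller) : Prop :=
  HasExtent a (slR α β κ K) ∧ HasExtent a (slN α β κ K) ∧
    HasExtent b (slM α β κ K) ∧ HasExtent b (slL α β κ K)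

/-! ### The model-matching problem -/

/-- The spatial indices `-E, …, E`. -/
abbrev Site (E : ℕ) : Type := {k : ℤ // k ∈ Finset.Icc (-(E : ℤ)) (E : ℤ)}

theorem card_site (E : ℕ) : Fintype.card (Site E) = 2 * E + 1 := by
  rw [Fintype.card_coe, Int.card_Icc]
  omega

/-- The sequence with value `a` at `0`, `b` at `±1`, `c` at `±2` and zero elsewhere. -/
def band (a b c : LaurentSeries ℝ) (k : ℤ) : LaurentSeries ℝ :=
  if k = 0 then a else if |k| = 1 then b else if |k| = 2 then c else 0

/-- A real constant as a transfer function. -/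
abbrev const (a : ℝ) : LaurentSeries ℝ := HahnSeries.C a

/-- The six scalar maps that appear in the cost. -/
inductive CostMap
  | n1 | r12 | n2 | r22 | l | m2
  deriving DecidableEq

instance : Fintype CostMap where
  elems := {.n1, .r12, .n2, .r22, .l, .m2}
  complete q := by cases q <;> decide

/-- The map `q` has sites `-(E + q.offset), …, E + q.offset`. -/
def CostMap.offset : CostMap → ℕ
  | .n1 => 2
  | .r12 => 1
  | .n2 => 2
  | .r22 => 1
  | .l => 3
  | .m2 => 2

/-- The entry of the Toeplitz matrix `V^q` on the diagonal `d` (row minus column). -/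
def Vdiag (α β κ : ℝ) : CostMap → ℤ → LaurentSeries ℝ
  | .n1 => fun d => (zVar ℝ - const β) * band (zVar ℝ - const α) (-const (α * κ)) 0 d
  | .r12 => fun d => band 1 0 0 d
  | .n2 => fun d => (zVar ℝ - const β) ^ 2 * band (zVar ℝ - const α) (-const (α * κ)) 0 d
  | .r22 => fun d => (zVar ℝ - const β) * band 1 0 0 d
  | .l => fun d => (zVar ℝ - const β) ^ 2 *
      band ((zVar ℝ - const α) ^ 2 + 2 * const (α * κ) ^ 2)
        (-(2 * const (α * κ) * (zVar ℝ - const α))) (const (α * κ) ^ 2) d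
  | .m2 => fun d => (zVar ℝ - const β) * band (zVar ℝ - const α) (-const (α * κ)) 0 d

/-- The entry of the vector `h^q` at the site `k`. -/
def hEntry (α β κ : ℝ) : CostMap → ℤ → LaurentSeries ℝ
  | .n1 => fun k => band (-1) 0 0 k
  | .r12 => fun _ => 0
  | .n2 => fun k => (zVar ℝ - const β) * band (-1) 0 0 k
  | .r22 => fun _ => 0
  | .l => fun k => (zVar ℝ - const β) * band (const α - zVar ℝ) (const (α * κ)) 0 k
  | .m2 => fun k => band (-1) 0 0 k

/-- The row indices of the stacked cost vector: the six blocks, each with its own sites. -/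
abbrev Row (E : ℕ) : Type := Σ q : CostMap, Site (E + q.offset)

/-- The stack of the six matrices `V^q`. -/
def Vstack (α β κ : ℝ) (E : ℕ) : Matrix (Row E) (Site (E + 1)) (LaurentSeries ℝ) :=
  Matrix.of fun r j => Vdiag α β κ r.1 (r.2.1 - j.1)

/-- The stack of the six vectors `h^q`. -/
def hstack (α β κ : ℝ) (E : ℕ) : Row E → LaurentSeries ℝ :=
  fun r => hEntry α β κ r.1 r.2.1

/-- `S = z⁻⁴ [0; I; 0]`. -/
def Smat (E : ℕ) : Matrix (Site (E + 1)) (Site E) (LaurentSeries ℝ) :=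
  Matrix.of fun i j => if i.1 = j.1 then (zVar ℝ)⁻¹ ^ 4 else 0

/-- The inverse spatial transform of `z⁻² + z⁻³ (σ + β)`, where `σ = α (1 + 2 κ cos θ)`. -/
def gEntry (α β κ : ℝ) (k : ℤ) : LaurentSeries ℝ :=
  (zVar ℝ)⁻¹ ^ 3 * band (zVar ℝ + const α + const β) (const (α * κ)) 0 k

/-- The vector `g`. -/
def gvec (α β κ : ℝ) (E : ℕ) : Site (E + 1) → LaurentSeries ℝ :=
  fun k => gEntry α β κ k.1

/-- The matrix `V^SL`, of size `(12 E + 28) × (2 E + 1)`. -/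
def VSL (α β κ : ℝ) (E : ℕ) : Matrix (Row E) (Site E) (LaurentSeries ℝ) :=
  Vstack α β κ E * Smat E

/-- The vector `h^SL`. -/
def hSL (α β κ : ℝ) (E : ℕ) : Row E → LaurentSeries ℝ :=
  (Vstack α β κ E).mulVec (gvec α β κ E) + hstack α β κ E

/-- The decision space `RH∞^{(2E+1) × 1}` of the model-matching problem. -/
def decisionSpace (E : ℕ) : Set (Site E → LaurentSeries ℝ) :=
  {f | ∀ k, f k ∈ RHinf ℝ}

/-- The cost `‖V^SL f + h^SL‖₂²`. -/
def modelCost (α β κ : ℝ) (E : ℕ) (f : Site E → LaurentSeries ℝ) : ℝ≥0∞ :=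
  columnNormSq ((VSL α β κ E).mulVec f + hSL α β κ E)

/-- The parameter `f` of a controller at the site `k`, defined by
`r¹² = z⁻² + z⁻³ (σ + β) + z⁻⁴ f`. -/
def parameter (α β κ : ℝ) (K : Controller) (k : ℤ) : LaurentSeries ℝ :=
  zVar ℝ ^ 4 * (zTransform (fun t => slR α β κ K k t 0 1) - gEntry α β κ k)

/-- Feasible controllers whose parameter `f` has extent `E`. -/
def SLFeasibleAt (α β κ : ℝ) (E : ℕ) (K : Controller) : Prop :=
  SLFeasible α β κ K ∧ HasExtent E (parameter α β κ K)

end SpatialSL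

end

/-!
Write `σ` for convolution in space by the coupling `α (δ₀ + κ (δ₋₁ + δ₁))`, and let `r = r¹²` be the
closed-loop response of `x¹` to `w^{x,2}`. The loop equations give `K r = m` with
`m = (z - σ) (z - β) r - 1`, and each of the other closed-loop maps is a polynomial in `z - β` and
`z - σ` applied to `r` or to `m`. Because `K` is causal, `m` vanishes at the times `0` and `1`,
which means `r = z⁻² + z⁻³ (σ + β) + z⁻⁴ f`. Nothing else constrains `f`: as `r` starts with a
delayed unit impulse, `K` is recovered from `r` and `m` by recursive deconvolution. Each application
of `z - σ` enlarges the extent by one, which gives the bounds on the extents, and a response of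
finite extent is in `RH∞` as soon as it is so at each site, because the sites are recovered from
finitely many spatial frequencies by an inverse discrete Fourier transform. The cost is then the sum
of the squared norms of the six entries of `F(P, K)`, each of them affine in `f`.
-/

noncomputable section

namespace SpatialSL

/-! ### Causal, stable and rational transfer functions -/

section Temporal

variable {𝕜 : Type*} [Field 𝕜]

theorem zVar_ne_zero : zVar 𝕜 ≠ 0 :=
  HahnSeries.single_ne_zero one_ne_zero

theorem algebraMap_laurentSeries (c : 𝕜) :
    algebraMap 𝕜 (LaurentSeries 𝕜) c = HahnSeries.C c := by
  rw [HahnSeries.algebraMap_apply', PowerSeries.algebraMap_apply, Algebra.algebraMap_self_apply,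
    HahnSeries.ofPowerSeries_C]

theorem coeff_C_mul (c : 𝕜) (G : LaurentSeries 𝕜) (t : ℤ) :
    (HahnSeries.C c * G).coeff t = c * G.coeff t :=
  HahnSeries.coeff_single_zero_mul

theorem coeff_zVar_mul (G : LaurentSeries 𝕜) (t : ℤ) :
    (zVar 𝕜 * G).coeff t = G.coeff (t + 1) := by
  simp [zVar, HahnSeries.coeff_single_mul]

theorem coeff_zVar_pow_mul (n : ℕ) (G : LaurentSeries 𝕜) (t : ℤ) :
    (zVar 𝕜 ^ n * G).coeff t = G.coeff (t + n) := by
  induction n generalizing t with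
  | zero => simp
  | succ n ih => rw [pow_succ', mul_assoc, coeff_zVar_mul, ih, Nat.cast_succ, add_assoc,
      add_comm (1 : ℤ)]

theorem aeval_zVar_monomial (n : ℕ) (a : 𝕜) :
    Polynomial.aeval (zVar 𝕜) (Polynomial.monomial n a) = HahnSeries.C a * zVar 𝕜 ^ n := by
  rw [Polynomial.aeval_monomial, algebraMap_laurentSeries]

theorem coeff_aeval_zVar_mul (D : Polynomial 𝕜) (G : LaurentSeries 𝕜) (t : ℤ) :
    (Polynomial.aeval (zVar 𝕜) D * G).coeff t
      = ∑ i ∈ Finset.range (D.natDegree + 1), D.coeff i * G.coeff (t + i) := by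
  conv_lhs => rw [D.as_sum_range]
  rw [map_sum, Finset.sum_mul, HahnSeries.coeff_sum]
  refine Finset.sum_congr rfl fun i _ => ?_
  rw [aeval_zVar_monomial, mul_assoc, coeff_C_mul, coeff_zVar_pow_mul]

theorem coeff_aeval_zVar (N : Polynomial 𝕜) (t : ℤ) :
    (Polynomial.aeval (zVar 𝕜) N).coeff t = if t ≤ 0 then N.coeff (-t).toNat else 0 := by
  induction N using Polynomial.induction_on' with
  | add p q hp hq =>
    rw [map_add, HahnSeries.coeff_add, hp, hq, Polynomial.coeff_add]
    split_ifs <;> simp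
  | monomial n a =>
    rw [aeval_zVar_monomial, coeff_C_mul, ← mul_one (zVar 𝕜 ^ n), coeff_zVar_pow_mul,
      HahnSeries.coeff_one, Polynomial.coeff_monomial]
    grind

theorem coeff_neg_aeval_zVar (N : Polynomial 𝕜) (n : ℕ) :
    (Polynomial.aeval (zVar 𝕜) N).coeff (-(n : ℤ)) = N.coeff n := by
  simp [coeff_aeval_zVar]

theorem aeval_zVar_injective :
    Function.Injective (Polynomial.aeval (R := 𝕜) (zVar 𝕜)) := fun p q h => by
  ext n
  rw [← coeff_neg_aeval_zVar, h, coeff_neg_aeval_zVar]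

theorem aeval_zVar_ne_zero {N : Polynomial 𝕜} (hN : N ≠ 0) : Polynomial.aeval (zVar 𝕜) N ≠ 0 :=
  (map_ne_zero_iff _ aeval_zVar_injective).mpr hN

theorem order_aeval_zVar {N : Polynomial 𝕜} (hN : N ≠ 0) :
    (Polynomial.aeval (zVar 𝕜) N).order = -(N.natDegree : ℤ) := by
  refine le_antisymm (HahnSeries.order_le_of_coeff_ne_zero ?_) ?_
  · simpa [coeff_neg_aeval_zVar] using hN
  · by_contra! hlt
    refine HahnSeries.coeff_order_eq_zero.not.mpr (aeval_zVar_ne_zero hN) ?_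
    rw [coeff_aeval_zVar, Polynomial.coeff_eq_zero_of_natDegree_lt (by omega), ite_self]

theorem coeff_zTransform (g : ℕ → 𝕜) (t : ℕ) : (zTransform g).coeff (t : ℤ) = g t := by
  rw [zTransform, LaurentSeries.coeff_coe_powerSeries, PowerSeries.coeff_mk]

theorem coeff_zTransform_of_neg (g : ℕ → 𝕜) {t : ℤ} (ht : t < 0) :
    (zTransform g).coeff t = 0 := by
  rw [zTransform, PowerSeries.coeff_coe, if_pos ht]

theorem zTransform_injective : Function.Injective (zTransform (𝕜 := 𝕜)) := fun g h hgh => by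
  ext t
  rw [← coeff_zTransform g t, hgh, coeff_zTransform]

theorem zTransform_add (g h : ℕ → 𝕜) : zTransform (g + h) = zTransform g + zTransform h :=
  map_add (HahnSeries.ofPowerSeries ℤ 𝕜) (PowerSeries.mk g) (PowerSeries.mk h)

theorem zTransform_sub (g h : ℕ → 𝕜) : zTransform (g - h) = zTransform g - zTransform h :=
  map_sub (HahnSeries.ofPowerSeries ℤ 𝕜) (PowerSeries.mk g) (PowerSeries.mk h)

theorem zTransform_zero : zTransform (0 : ℕ → 𝕜) = 0 :=
  map_zero (HahnSeries.ofPowerSeries ℤ 𝕜)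

theorem zTransform_sum {ι : Type*} (s : Finset ι) (g : ι → ℕ → 𝕜) :
    zTransform (∑ i ∈ s, g i) = ∑ i ∈ s, zTransform (g i) :=
  map_sum (⟨⟨zTransform, zTransform_zero⟩, zTransform_add⟩ : (ℕ → 𝕜) →+ LaurentSeries 𝕜) g s

theorem zTransform_smul (c : 𝕜) (g : ℕ → 𝕜) :
    zTransform (c • g) = HahnSeries.C c * zTransform g := by
  rw [zTransform, zTransform, ← HahnSeries.ofPowerSeries_C, ← map_mul]
  congr 1
  ext t
  simp

theorem zTransform_single (c : 𝕜) : zTransform (Pi.single 0 c) = HahnSeries.C c := by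
  rw [zTransform, ← HahnSeries.ofPowerSeries_C]
  congr 1
  ext t
  simp [PowerSeries.coeff_C, Pi.single_apply]

theorem zTransform_tail (g : ℕ → 𝕜) :
    zTransform (fun t => g (t + 1)) = zVar 𝕜 * (zTransform g - HahnSeries.C (g 0)) := by
  ext t
  rw [coeff_zVar_mul, HahnSeries.coeff_sub, HahnSeries.C_apply]
  rcases lt_trichotomy t (-1) with ht | rfl | ht
  · rw [coeff_zTransform_of_neg _ (by omega), coeff_zTransform_of_neg _ (by omega),
      HahnSeries.coeff_single_of_ne (by omega), sub_zero]
  · rw [coeff_zTransform_of_neg _ (by omega)]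
    simpa using (sub_eq_zero.mpr (coeff_zTransform g 0)).symm
  · lift t to ℕ using (by omega)
    rw [coeff_zTransform, HahnSeries.coeff_single_of_ne (by omega), sub_zero]
    exact (coeff_zTransform g (t + 1)).symm

theorem zTransform_eq_add_inv_mul (g : ℕ → 𝕜) :
    zTransform g = HahnSeries.C (g 0) + (zVar 𝕜)⁻¹ * zTransform (fun t => g (t + 1)) := by
  rw [zTransform_tail, inv_mul_cancel_left₀ zVar_ne_zero, add_sub_cancel]

/-- The causal transfer functions: no response before the impulse. -/
def causal (𝕜 : Type*) [Field 𝕜] : Submodule 𝕜 (LaurentSeries 𝕜) where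
  carrier := {G | ∀ t < 0, G.coeff t = 0}
  add_mem' hG hH t ht := by rw [HahnSeries.coeff_add, hG t ht, hH t ht, add_zero]
  zero_mem' _ _ := HahnSeries.coeff_zero
  smul_mem' c G hG t ht := by rw [HahnSeries.coeff_smul, hG t ht, smul_zero]

theorem zTransform_mem_causal (g : ℕ → 𝕜) : zTransform g ∈ causal 𝕜 :=
  fun _ => coeff_zTransform_of_neg g

theorem zTransform_coeff {G : LaurentSeries 𝕜} (hG : G ∈ causal 𝕜) :
    (zTransform fun t => G.coeff t) = G := by
  ext t
  rcases lt_or_ge t 0 with ht | ht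
  · rw [hG t ht, coeff_zTransform_of_neg _ ht]
  · lift t to ℕ using ht
    rw [coeff_zTransform]

theorem mem_causal_of_degree_le {N D : Polynomial 𝕜} {G : LaurentSeries 𝕜} (hD : D ≠ 0)
    (hdeg : N.degree ≤ D.degree)
    (hG : Polynomial.aeval (zVar 𝕜) D * G = Polynomial.aeval (zVar 𝕜) N) : G ∈ causal 𝕜 := by
  rcases eq_or_ne G 0 with rfl | hG0
  · exact zero_mem _
  have hN : N ≠ 0 := by
    rintro rfl
    exact mul_ne_zero (aeval_zVar_ne_zero hD) hG0 (hG.trans (map_zero _))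
  have hord := HahnSeries.order_mul (aeval_zVar_ne_zero hD) hG0
  rw [hG, order_aeval_zVar hN, order_aeval_zVar hD] at hord
  have := Polynomial.natDegree_le_natDegree hdeg
  exact fun t ht => HahnSeries.coeff_eq_zero_of_lt_order (by omega)

theorem degree_le_of_mem_causal {N D : Polynomial 𝕜} {G : LaurentSeries 𝕜} (hD : D ≠ 0)
    (hG : Polynomial.aeval (zVar 𝕜) D * G = Polynomial.aeval (zVar 𝕜) N) (hc : G ∈ causal 𝕜) :
    N.degree ≤ D.degree := by
  rw [Polynomial.degree_le_iff_coeff_zero]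
  intro n hn
  have hlt : D.natDegree < n := (Polynomial.natDegree_lt_iff_degree_lt hD).mpr hn
  rw [← coeff_neg_aeval_zVar, ← hG, coeff_aeval_zVar_mul]
  refine Finset.sum_eq_zero fun i hi => ?_
  rw [Finset.mem_range] at hi
  rw [hc _ (by omega), mul_zero]

variable [Algebra 𝕜 ℂ]

/-- Schur stability of a polynomial: all its complex roots lie in the open unit disk. -/
def IsSchur (D : Polynomial 𝕜) : Prop :=
  ∀ s : ℂ, Polynomial.aeval s D = 0 → ‖s‖ < 1

theorem IsSchur.ne_zero {D : Polynomial 𝕜} (hD : IsSchur D) : D ≠ 0 := by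
  rintro rfl
  simpa using hD 1 (map_zero _)

theorem isSchur_one : IsSchur (1 : Polynomial 𝕜) := by
  simp [IsSchur]

theorem isSchur_X : IsSchur (Polynomial.X : Polynomial 𝕜) := by
  simp +contextual [IsSchur]

theorem IsSchur.mul {D D' : Polynomial 𝕜} (hD : IsSchur D) (hD' : IsSchur D') :
    IsSchur (D * D') := fun s hs => by
  rw [map_mul, mul_eq_zero] at hs
  exact hs.elim (hD s) (hD' s)

/-- The stable rational transfer functions, causal or not. -/
def stableRational (𝕜 : Type*) [Field 𝕜] [Algebra 𝕜 ℂ] : Subalgebra 𝕜 (LaurentSeries 𝕜) where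
  carrier := {G | ∃ N D : Polynomial 𝕜, IsSchur D ∧
      Polynomial.aeval (zVar 𝕜) D * G = Polynomial.aeval (zVar 𝕜) N}
  mul_mem' := by
    rintro G H ⟨N, D, hD, hG⟩ ⟨N', D', hD', hH⟩
    refine ⟨N * N', D * D', hD.mul hD', ?_⟩
    rw [map_mul, map_mul, ← hG, ← hH, mul_mul_mul_comm]
  add_mem' := by
    rintro G H ⟨N, D, hD, hG⟩ ⟨N', D', hD', hH⟩
    refine ⟨N * D' + N' * D, D * D', hD.mul hD', ?_⟩
    rw [map_add, map_mul, map_mul, map_mul, ← hG, ← hH]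
    ring
  algebraMap_mem' c := ⟨Polynomial.C c, 1, isSchur_one, by simp⟩

theorem C_mem_stableRational (c : 𝕜) : HahnSeries.C c ∈ stableRational 𝕜 := by
  rw [← algebraMap_laurentSeries]
  exact (stableRational 𝕜).algebraMap_mem c

theorem zVar_mem_stableRational : zVar 𝕜 ∈ stableRational 𝕜 :=
  ⟨Polynomial.X, 1, isSchur_one, by simp⟩

theorem inv_zVar_mem_stableRational : (zVar 𝕜)⁻¹ ∈ stableRational 𝕜 :=
  ⟨1, Polynomial.X, isSchur_X, by simp [zVar_ne_zero]⟩

theorem mem_RHinf_iff {G : LaurentSeries 𝕜} :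
    G ∈ RHinf 𝕜 ↔ G ∈ causal 𝕜 ∧ G ∈ stableRational 𝕜 :=
  ⟨fun ⟨N, D, hdeg, hD, hG⟩ =>
      ⟨mem_causal_of_degree_le (IsSchur.ne_zero hD) hdeg hG, N, D, hD, hG⟩,
    fun ⟨hc, N, D, hD, hG⟩ => ⟨N, D, degree_le_of_mem_causal hD.ne_zero hG hc, hD, hG⟩⟩

theorem zTransform_mem_RHinf_iff {g : ℕ → 𝕜} :
    zTransform g ∈ RHinf 𝕜 ↔ zTransform g ∈ stableRational 𝕜 := by
  rw [mem_RHinf_iff, and_iff_right (zTransform_mem_causal g)]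

end Temporal

/-! ### Change of coefficients -/

section CoeffMap

variable {𝕜 𝕃 : Type*} [Field 𝕜] [Field 𝕃] (φ : 𝕜 →+* 𝕃)

/-- Application of a ring homomorphism to each coefficient of a transfer function. -/
def coeffMap : LaurentSeries 𝕜 →+* LaurentSeries 𝕃 where
  toFun G := G.map φ
  map_zero' := HahnSeries.ext (funext fun _ => map_zero φ)
  map_one' := HahnSeries.map_one φ.toMonoidWithZeroHom
  map_add' _ _ := HahnSeries.ext (funext fun _ => map_add φ _ _)
  map_mul' _ _ := HahnSeries.map_mul (φ : 𝕜 →ₙ+* 𝕃)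

theorem coeff_coeffMap (G : LaurentSeries 𝕜) (t : ℤ) :
    (coeffMap φ G).coeff t = φ (G.coeff t) := rfl

theorem coeffMap_zTransform (g : ℕ → 𝕜) : coeffMap φ (zTransform g) = zTransform (φ ∘ g) := by
  ext t
  rw [coeff_coeffMap]
  rcases lt_or_ge t 0 with ht | ht
  · rw [coeff_zTransform_of_neg _ ht, coeff_zTransform_of_neg _ ht, map_zero]
  · lift t to ℕ using ht
    rw [coeff_zTransform, coeff_zTransform, Function.comp_apply]

theorem coeffMap_aeval_zVar (N : Polynomial 𝕜) :
    coeffMap φ (Polynomial.aeval (zVar 𝕜) N) = Polynomial.aeval (zVar 𝕃) (N.map φ) := by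
  ext t
  rw [coeff_coeffMap, coeff_aeval_zVar, coeff_aeval_zVar, Polynomial.coeff_map, apply_ite φ,
    map_zero]

end CoeffMap

theorem coeffMap_mem_stableRational {𝕜 : Type*} [Field 𝕜] [Algebra 𝕜 ℂ] {G : LaurentSeries 𝕜}
    (hG : G ∈ stableRational 𝕜) : coeffMap (algebraMap 𝕜 ℂ) G ∈ stableRational ℂ := by
  obtain ⟨N, D, hD, h⟩ := hG
  refine ⟨N.map (algebraMap 𝕜 ℂ), D.map (algebraMap 𝕜 ℂ), fun s hs => hD s ?_, ?_⟩
  · rwa [Polynomial.aeval_map_algebraMap] at hs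
  · rw [← coeffMap_aeval_zVar, ← coeffMap_aeval_zVar, ← map_mul, h]

theorem exists_map_ofReal_eq_mul_conj (D : Polynomial ℂ) :
    ∃ P : Polynomial ℝ, P.map (algebraMap ℝ ℂ) = D * D.map (starRingEnd ℂ) := by
  rw [← Polynomial.mem_lifts, Polynomial.lifts_iff_coeff_lifts]
  have hconj : (D * D.map (starRingEnd ℂ)).map (starRingEnd ℂ) = D * D.map (starRingEnd ℂ) := by
    have : (starRingEnd ℂ).comp (starRingEnd ℂ) = RingHom.id ℂ := RingHom.ext Complex.conj_conj
    rw [Polynomial.map_mul, Polynomial.map_map, this, Polynomial.map_id, mul_comm]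
  intro n
  obtain ⟨r, hr⟩ := Complex.conj_eq_iff_real.mp
    ((Polynomial.coeff_map _ n).symm.trans (congrArg (Polynomial.coeff · n) hconj))
  exact ⟨r, hr.symm⟩

theorem IsSchur.map_conj {D : Polynomial ℂ} (hD : IsSchur D) :
    IsSchur (D.map (starRingEnd ℂ)) := fun s hs => by
  have h := Polynomial.eval_map_apply (f := starRingEnd ℂ) (p := D) (starRingEnd ℂ s)
  rw [Complex.conj_conj, ← Polynomial.coe_aeval_eq_eval, hs, eq_comm, map_eq_zero] at h
  simpa using hD _ h

theorem exists_aeval_zVar_eq_of_coeffMap {P : Polynomial ℂ} {G : LaurentSeries ℝ}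
    (h : Polynomial.aeval (zVar ℂ) P = coeffMap (algebraMap ℝ ℂ) G) :
    ∃ N : Polynomial ℝ, Polynomial.aeval (zVar ℝ) N = G := by
  have hP : P ∈ Polynomial.lifts (algebraMap ℝ ℂ) := by
    rw [Polynomial.lifts_iff_coeff_lifts]
    intro n
    rw [← coeff_neg_aeval_zVar, h, coeff_coeffMap]
    exact ⟨_, rfl⟩
  obtain ⟨N, rfl⟩ := (Polynomial.mem_lifts _).mp hP
  exact ⟨N, (coeffMap _).injective ((coeffMap_aeval_zVar _ N).trans h)⟩

-- A complex denominator is made real by multiplying it by its conjugate.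
theorem coeffMap_mem_stableRational_iff {G : LaurentSeries ℝ} :
    coeffMap (algebraMap ℝ ℂ) G ∈ stableRational ℂ ↔ G ∈ stableRational ℝ := by
  refine ⟨fun ⟨N, D, hD, h⟩ => ?_, coeffMap_mem_stableRational⟩
  obtain ⟨P, hP⟩ := exists_map_ofReal_eq_mul_conj D
  have hPG : Polynomial.aeval (zVar ℂ) (N * D.map (starRingEnd ℂ))
      = coeffMap (algebraMap ℝ ℂ) (Polynomial.aeval (zVar ℝ) P * G) := by
    rw [map_mul, map_mul, coeffMap_aeval_zVar, hP, map_mul, ← h, mul_right_comm]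
  obtain ⟨N₀, hN₀⟩ := exists_aeval_zVar_eq_of_coeffMap hPG
  refine ⟨N₀, P, fun s hs => hD.mul hD.map_conj s ?_, hN₀.symm⟩
  rw [← hP, Polynomial.aeval_map_algebraMap, hs]

/-! ### Summability of the impulse response -/

theorem summable_of_le_mul_add {a b : ℕ → ℝ} {c : ℝ} (hc : c < 1)
    (ha : ∀ n, 0 ≤ a n) (hb : Summable b) (h : ∀ n, a (n + 1) ≤ c * a n + b n) :
    Summable a := by
  refine summable_of_sum_range_le (c := (a 0 + ∑' n, |b n|) / (1 - c)) ha fun n => ?_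
  rw [le_div_iff₀ (sub_pos.mpr hc)]
  have hsucc : ∑ i ∈ Finset.range n, a (i + 1)
      ≤ c * ∑ i ∈ Finset.range n, a i + ∑ i ∈ Finset.range n, b i := by
    rw [Finset.mul_sum, ← Finset.sum_add_distrib]
    exact Finset.sum_le_sum fun i _ => h i
  have hmono : ∑ i ∈ Finset.range n, a i ≤ ∑ i ∈ Finset.range n, a (i + 1) + a 0 := by
    rw [← Finset.sum_range_succ', Finset.sum_range_succ]
    exact le_add_of_nonneg_right (ha n)
  have hbound : ∑ i ∈ Finset.range n, b i ≤ ∑' n, |b n| :=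
    (Finset.sum_le_sum fun i _ => le_abs_self (b i)).trans
      (hb.abs.sum_le_tsum _ fun i _ => abs_nonneg (b i))
  linarith

section Summability

variable {𝕜 : Type*} [NormedField 𝕜]

theorem summable_norm_coeff_iff {G : LaurentSeries 𝕜} :
    (Summable fun t : ℤ => ‖G.coeff t‖) ↔ Summable fun t : ℕ => ‖G.coeff t‖ := by
  refine ⟨fun h => h.comp_injective Nat.cast_injective, fun h => h.of_nat_of_neg ?_⟩
  refine summable_of_ne_finset_zero (s := Finset.range ((-G.order).toNat + 1)) fun n hn => ?_
  rw [Finset.mem_range] at hn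
  rw [HahnSeries.coeff_eq_zero_of_lt_order (by omega), norm_zero]

theorem summable_norm_coeff_aeval_zVar (N : Polynomial 𝕜) :
    Summable fun t : ℤ => ‖(Polynomial.aeval (zVar 𝕜) N).coeff t‖ := by
  refine summable_norm_coeff_iff.mpr
    (summable_of_ne_finset_zero (s := {0}) fun t ht => ?_)
  rw [Finset.mem_singleton] at ht
  rw [coeff_aeval_zVar, if_neg (by omega), norm_zero]

theorem summable_norm_coeff_of_sub_mul {G : LaurentSeries 𝕜} {p : 𝕜} (hp : ‖p‖ < 1)
    (h : Summable fun t : ℤ => ‖((zVar 𝕜 - HahnSeries.C p) * G).coeff t‖) :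
    Summable fun t : ℤ => ‖G.coeff t‖ := by
  rw [summable_norm_coeff_iff] at h ⊢
  refine summable_of_le_mul_add hp (fun _ => norm_nonneg _) h fun t => ?_
  rw [sub_mul, HahnSeries.coeff_sub, coeff_zVar_mul, coeff_C_mul, Nat.cast_succ, ← norm_mul]
  exact norm_le_norm_add_norm_sub' _ _

theorem summable_norm_coeff_of_prod_mul {s : Multiset 𝕜} (hs : ∀ p ∈ s, ‖p‖ < 1)
    {G : LaurentSeries 𝕜}
    (h : Summable fun t : ℤ =>
      ‖((s.map fun p => zVar 𝕜 - HahnSeries.C p).prod * G).coeff t‖) :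
    Summable fun t : ℤ => ‖G.coeff t‖ := by
  induction s using Multiset.induction_on generalizing G with
  | empty => simpa using h
  | cons p s ih =>
    rw [Multiset.forall_mem_cons] at hs
    rw [Multiset.map_cons, Multiset.prod_cons, mul_assoc] at h
    exact ih hs.2 (summable_norm_coeff_of_sub_mul hs.1 h)

end Summability

theorem aeval_zVar_eq_prod_roots (D : Polynomial ℂ) :
    Polynomial.aeval (zVar ℂ) D
      = HahnSeries.C D.leadingCoeff * (D.roots.map fun p => zVar ℂ - HahnSeries.C p).prod := by
  conv_lhs => rw [(IsAlgClosed.splits D).eq_prod_roots]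
  simp [map_multiset_prod, Multiset.map_map, algebraMap_laurentSeries]

theorem summable_norm_coeff {G : LaurentSeries ℂ} (hG : G ∈ stableRational ℂ) :
    Summable fun t : ℤ => ‖G.coeff t‖ := by
  obtain ⟨N, D, hD, h⟩ := hG
  refine summable_norm_coeff_of_prod_mul (s := D.roots) (fun p hp => hD p ?_) ?_
  · exact (Polynomial.mem_roots'.mp hp).2
  · have hN := summable_norm_coeff_aeval_zVar N
    rw [← h, aeval_zVar_eq_prod_roots, mul_assoc] at hN
    simp only [coeff_C_mul, norm_mul] at hN
    refine (summable_mul_left_iff ?_).mp hN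
    exact norm_ne_zero_iff.mpr (Polynomial.leadingCoeff_ne_zero.mpr hD.ne_zero)

theorem summable_sq_coeff {G : LaurentSeries ℝ} (hG : G ∈ stableRational ℝ) :
    Summable fun t : ℤ => G.coeff t ^ 2 := by
  have h : Summable fun t : ℤ => |G.coeff t| := by
    simpa [coeff_coeffMap] using summable_norm_coeff (coeffMap_mem_stableRational hG)
  refine Summable.of_norm_bounded_eventually h ?_
  filter_upwards [h.tendsto_cofinite_zero.eventually_le_const zero_lt_one] with t ht
  rw [norm_pow, Real.norm_eq_abs, sq]
  exact mul_le_of_le_one_left (abs_nonneg _) ht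

/-! ### Finite extent -/

section Extent

variable {X : Type*} {E F : ℕ}

theorem HasExtent.mono [Zero X] {x : ℤ → X} (hx : HasExtent E x) (hEF : E ≤ F) : HasExtent F x :=
  fun k hk => hx k (lt_of_le_of_lt (by exact_mod_cast hEF) hk)

theorem HasExtent.eq_zero_of_notMem_Icc [Zero X] {x : ℤ → X} (hx : HasExtent E x) {k : ℤ}
    (hk : k ∉ Finset.Icc (-(E : ℤ)) E) : x k = 0 := by
  rw [Finset.mem_Icc, ← abs_le, not_le] at hk
  exact hx k hk

theorem HasExtent.map {Y : Type*} [Zero X] [Zero Y] {x : ℤ → X} (hx : HasExtent E x) {f : X → Y}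
    (hf : f 0 = 0) : HasExtent E fun k => f (x k) :=
  fun k hk => (congrArg f (hx k hk)).trans hf

theorem HasExtent.add [AddZeroClass X] {x y : ℤ → X} (hx : HasExtent E x) (hy : HasExtent E y) :
    HasExtent E (x + y) := fun k hk => by
  rw [Pi.add_apply, hx k hk, hy k hk, add_zero]

theorem HasExtent.sub [SubNegZeroMonoid X] {x y : ℤ → X} (hx : HasExtent E x)
    (hy : HasExtent E y) : HasExtent E (x - y) := fun k hk => by
  rw [Pi.sub_apply, hx k hk, hy k hk, sub_zero]

theorem hasExtent_single [Zero X] (a : X) : HasExtent E (Pi.single 0 a) := fun k hk => by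
  have hk0 : k ≠ 0 := by
    rintro rfl
    exact (Nat.cast_nonneg E).not_gt (abs_zero (α := ℤ) ▸ hk)
  rw [Pi.single_eq_of_ne hk0]

theorem hasExtent_matrix_iff [Zero X] {T m n : Type*} {G : ℤ → T → Matrix m n X} :
    HasExtent E G ↔ ∀ i j, HasExtent E fun k t => G k t i j :=
  ⟨fun h i j k hk => funext fun t => congrFun (congrFun (congrFun (h k hk) t) i) j,
    fun h k hk => funext fun t => Matrix.ext fun i j => congrFun (h i j k hk) t⟩

end Extent

/-! ### The discrete Fourier transform in space -/

theorem sum_zpow_pow_of_isPrimitiveRoot {𝕜 : Type*} [Field 𝕜] {ζ : 𝕜} {n : ℕ}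
    (hζ : IsPrimitiveRoot ζ n) (d : ℤ) :
    ∑ j ∈ Finset.range n, (ζ ^ d) ^ j = if (n : ℤ) ∣ d then (n : 𝕜) else 0 := by
  split_ifs with h <;> rw [← hζ.zpow_eq_one_iff_dvd] at h
  · simp [h]
  · rw [geom_sum_eq h, ← zpow_natCast, zpow_comm, hζ.zpow_eq_one, one_zpow, sub_self, zero_div]

/-- The `j`-th of `n` equally spaced spatial frequencies. -/
def gridFrequency (n j : ℕ) : ℝ := 2 * Real.pi * j / n

theorem exp_mul_gridFrequency (n j : ℕ) (d : ℤ) :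
    Complex.exp (Complex.I * d * gridFrequency n j)
      = (Complex.exp (2 * Real.pi * Complex.I / n) ^ d) ^ j := by
  rw [← Complex.exp_int_mul, ← Complex.exp_nat_mul, gridFrequency]
  congr 1
  push_cast
  ring

theorem HasExtent.spatialTransform_eq {E : ℕ} {G : ℤ → ℕ → ℝ} (hG : HasExtent E G) (θ : ℝ) :
    spatialTransform G θ
      = ∑ k ∈ Finset.Icc (-(E : ℤ)) E, Complex.exp (-(Complex.I * k * θ)) • ((↑) ∘ G k) := by
  ext t
  rw [Finset.sum_apply]
  refine (tsum_eq_sum fun k hk => ?_).trans (Finset.sum_congr rfl fun k _ => mul_comm _ _)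
  rw [hG.eq_zero_of_notMem_Icc hk, Pi.zero_apply, Complex.ofReal_zero, zero_mul]

theorem HasExtent.sum_spatialTransform_gridFrequency {E n : ℕ} {G : ℤ → ℕ → ℝ}
    (hG : HasExtent E G) (hn : 2 * E < n) {m : ℤ} (hm : |m| ≤ E) :
    ∑ j ∈ Finset.range n,
        Complex.exp (Complex.I * m * gridFrequency n j) • spatialTransform G (gridFrequency n j)
      = (n : ℂ) • ((↑) ∘ G m) := by
  have hζ := Complex.isPrimitiveRoot_exp n (by omega)
  have hexp (j : ℕ) (k : ℤ) : Complex.exp (Complex.I * m * gridFrequency n j) *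
      Complex.exp (-(Complex.I * k * gridFrequency n j))
        = (Complex.exp (2 * Real.pi * Complex.I / n) ^ (m - k)) ^ j := by
    rw [← exp_mul_gridFrequency, ← Complex.exp_add]
    congr 1
    push_cast
    ring
  simp only [hG.spatialTransform_eq, Finset.smul_sum, smul_smul, hexp]
  rw [Finset.sum_comm]
  simp only [← Finset.sum_smul, sum_zpow_pow_of_isPrimitiveRoot hζ]
  rw [Finset.sum_eq_single_of_mem m (Finset.mem_Icc.mpr (abs_le.mp hm)), sub_self,
    if_pos (dvd_zero _)]
  intro k hk hkm
  have hlt : |m - k| < n := by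
    rw [Finset.mem_Icc] at hk
    rw [abs_le] at hm
    rw [abs_lt]
    omega
  have hdvd : ¬(n : ℤ) ∣ m - k := fun h =>
    hkm (sub_eq_zero.mp (Int.eq_zero_of_abs_lt_dvd h hlt)).symm
  rw [if_neg hdvd, zero_smul]

/-! ### Stability site by site -/

/-- The impulse responses whose transfer function at each site is stable and rational. -/
def siteStable : Submodule ℝ (ℤ → ℕ → ℝ) where
  carrier := {x | ∀ k, zTransform (x k) ∈ stableRational ℝ}
  add_mem' hx hy k := by
    rw [Pi.add_apply, zTransform_add]
    exact add_mem (hx k) (hy k)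
  zero_mem' k := by
    rw [Pi.zero_apply, zTransform_zero]
    exact zero_mem _
  smul_mem' c x hx k := by
    rw [Pi.smul_apply, zTransform_smul]
    exact mul_mem (C_mem_stableRational _) (hx k)

theorem ofReal_comp_mem_stableRational_iff {g : ℕ → ℝ} :
    zTransform (((↑) : ℝ → ℂ) ∘ g) ∈ stableRational ℂ ↔ zTransform g ∈ stableRational ℝ := by
  rw [← coeffMap_mem_stableRational_iff, coeffMap_zTransform]
  rfl

theorem zTransform_sum_smul_mem_stableRational {ι : Type*} {s : Finset ι} {c : ι → ℂ}
    {g : ι → ℕ → ℂ} (hg : ∀ i ∈ s, zTransform (g i) ∈ stableRational ℂ) :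
    zTransform (∑ i ∈ s, c i • g i) ∈ stableRational ℂ := by
  rw [zTransform_sum]
  refine sum_mem fun i hi => ?_
  rw [zTransform_smul]
  exact mul_mem (C_mem_stableRational _) (hg i hi)

theorem HasExtent.mem_siteStable {E : ℕ} {G : ℤ → ℕ → ℝ} (hG : HasExtent E G)
    (h : ∀ θ, zTransform (spatialTransform G θ) ∈ stableRational ℂ) : G ∈ siteStable := fun m => by
  by_cases hm : |m| ≤ (E : ℤ)
  · have hinv : ((2 * E + 1 : ℕ) : ℂ)⁻¹ • ∑ j ∈ Finset.range (2 * E + 1),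
        Complex.exp (Complex.I * m * gridFrequency (2 * E + 1) j) •
          spatialTransform G (gridFrequency (2 * E + 1) j) = (↑) ∘ G m := by
      rw [hG.sum_spatialTransform_gridFrequency (Nat.lt_succ_self _) hm,
        inv_smul_smul₀ (Nat.cast_ne_zero.mpr (Nat.succ_ne_zero _))]
    rw [← ofReal_comp_mem_stableRational_iff, ← hinv, zTransform_smul]
    exact mul_mem (C_mem_stableRational _)
      (zTransform_sum_smul_mem_stableRational fun j _ => h _)
  · rw [hG m (not_le.mp hm), zTransform_zero]
    exact zero_mem _

theorem HasExtent.isRHinf {E : ℕ} {G : ℤ → ℕ → ℝ} (hG : HasExtent E G) (h : G ∈ siteStable) :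
    IsRHinf G := by
  refine ⟨fun t => summable_of_ne_finset_zero fun k hk =>
    congrFun (hG.eq_zero_of_notMem_Icc hk) t, fun θ => zTransform_mem_RHinf_iff.mpr ?_⟩
  rw [hG.spatialTransform_eq]
  exact zTransform_sum_smul_mem_stableRational fun k _ =>
    ofReal_comp_mem_stableRational_iff.mpr (h k)

theorem HasExtent.isRHinf_iff {E : ℕ} {G : ℤ → ℕ → ℝ} (hG : HasExtent E G) :
    IsRHinf G ↔ G ∈ siteStable :=
  ⟨fun h => hG.mem_siteStable fun θ => zTransform_mem_RHinf_iff.mp (h.2 θ), hG.isRHinf⟩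

/-! ### Multiplication by `z - β` and `z - σ` -/

/-- Multiplication by `z` of impulse responses that vanish at time `0`. -/
def tail : Module.End ℝ (ℤ → ℕ → ℝ) where
  toFun x k t := x k (t + 1)
  map_add' _ _ := rfl
  map_smul' _ _ := rfl

/-- The translation of an impulse response by `-c` in space. -/
def shift (c : ℤ) : Module.End ℝ (ℤ → ℕ → ℝ) where
  toFun x k t := x (k + c) t
  map_add' _ _ := rfl
  map_smul' _ _ := rfl

/-- Multiplication by `z - β` of impulse responses that vanish at time `0`. -/
def advance₁ (β : ℝ) : Module.End ℝ (ℤ → ℕ → ℝ) := tail - β • 1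

/-- Multiplication by `z - σ` of impulse responses that vanish at time `0`, where
`σ = α (1 + 2 κ cos θ)` acts as a tridiagonal convolution in space. -/
def advance₂ (α κ : ℝ) : Module.End ℝ (ℤ → ℕ → ℝ) :=
  tail - α • (1 + κ • (shift (-1) + shift 1))

/-- The identity system: the unit impulse at site `0` and time `0`. -/
def unitImpulse : ℤ → ℕ → ℝ := Pi.single 0 (Pi.single 0 1)

section Advance

variable {E : ℕ} {x : ℤ → ℕ → ℝ} {k : ℤ}

theorem advance₁_apply (β : ℝ) (x : ℤ → ℕ → ℝ) (k : ℤ) (t : ℕ) :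
    advance₁ β x k t = x k (t + 1) - β * x k t :=
  rfl

theorem advance₂_apply (α κ : ℝ) (x : ℤ → ℕ → ℝ) (k : ℤ) (t : ℕ) :
    advance₂ α κ x k t = x k (t + 1) - α * (x k t + κ * (x (k - 1) t + x (k + 1) t)) :=
  rfl

theorem advance₁_eq_iff {β : ℝ} {y : ℤ → ℕ → ℝ} :
    advance₁ β x = y ↔ ∀ k t, x k (t + 1) = β * x k t + y k t := by
  simp only [funext_iff, advance₁_apply, sub_eq_iff_eq_add']

theorem advance₂_eq_iff {α κ : ℝ} {y : ℤ → ℕ → ℝ} :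
    advance₂ α κ x = y ↔
      ∀ k t, x k (t + 1) = α * (x k t + κ * (x (k - 1) t + x (k + 1) t)) + y k t := by
  simp only [funext_iff, advance₂_apply, sub_eq_iff_eq_add']

theorem advance₂_advance₁ (α β κ : ℝ) (x : ℤ → ℕ → ℝ) :
    advance₂ α κ (advance₁ β x) = advance₁ β (advance₂ α κ x) := by
  ext k t
  simp only [advance₁_apply, advance₂_apply]
  ring

theorem advance₁_apply_zero (β : ℝ) (h0 : x k 0 = 0) (h1 : x k 1 = 0) : advance₁ β x k 0 = 0 := by
  rw [advance₁_apply, h0, h1, mul_zero, sub_zero]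

theorem advance₂_apply_zero (α κ : ℝ) (h0 : ∀ k, x k 0 = 0) (h1 : x k 1 = 0) :
    advance₂ α κ x k 0 = 0 := by
  rw [advance₂_apply, h0, h0, h0, h1, add_zero, mul_zero, add_zero, mul_zero, sub_zero]

theorem hasExtent_unitImpulse : HasExtent E unitImpulse := hasExtent_single _

theorem HasExtent.smul (h : HasExtent E x) (c : ℝ) : HasExtent E (c • x) :=
  h.map (f := (c • ·)) (smul_zero c)

theorem HasExtent.tail (h : HasExtent E x) : HasExtent E (tail x) :=
  h.map (f := fun g t => g (t + 1)) rfl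

theorem HasExtent.shift (h : HasExtent E x) {F : ℕ} {c : ℤ} (hc : |c| ≤ F) :
    HasExtent (E + F) (shift c x) := fun k hk => h (k + c) (by
  rw [abs_le] at hc
  rw [lt_abs] at hk ⊢
  push_cast at hk
  omega)

theorem HasExtent.neighbours (h : HasExtent E x) (κ : ℝ) :
    HasExtent (E + 1) (κ • (SpatialSL.shift (-1) x + SpatialSL.shift 1 x)) :=
  ((h.shift (by norm_num)).add (h.shift (by norm_num))).smul κ

theorem HasExtent.advance₁ (h : HasExtent E x) (β : ℝ) : HasExtent E (advance₁ β x) :=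
  h.tail.sub (h.smul β)

theorem HasExtent.advance₂ (h : HasExtent E x) (α κ : ℝ) : HasExtent (E + 1) (advance₂ α κ x) :=
  (h.tail.mono E.le_succ).sub (((h.mono E.le_succ).add (h.neighbours κ)).smul α)

theorem zTransform_tail_apply (x : ℤ → ℕ → ℝ) (k : ℤ) :
    zTransform (tail x k) = zVar ℝ * (zTransform (x k) - HahnSeries.C (x k 0)) :=
  zTransform_tail _

theorem zTransform_advance₁ (β : ℝ) (h0 : x k 0 = 0) :
    zTransform (advance₁ β x k) = (zVar ℝ - const β) * zTransform (x k) := by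
  change zTransform (tail x k - β • x k) = _
  rw [zTransform_sub, zTransform_tail_apply, zTransform_smul, h0, map_zero]
  ring

theorem zTransform_advance₂ (α κ : ℝ) (h0 : x k 0 = 0) :
    zTransform (advance₂ α κ x k) = (zVar ℝ - const α) * zTransform (x k) +
      -const (α * κ) * (zTransform (x (k - 1)) + zTransform (x (k + 1))) := by
  change zTransform (tail x k - α • (x k + κ • (x (k - 1) + x (k + 1)))) = _
  rw [zTransform_sub, zTransform_tail_apply, zTransform_smul, zTransform_add, zTransform_smul,
    zTransform_add, h0, map_zero, const, const, map_mul]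
  ring

theorem unitImpulse_mem_siteStable : unitImpulse ∈ siteStable := fun k => by
  rcases eq_or_ne k 0 with rfl | hk
  · rw [unitImpulse, Pi.single_eq_same, zTransform_single]
    exact C_mem_stableRational _
  · rw [unitImpulse, Pi.single_eq_of_ne hk, zTransform_zero]
    exact zero_mem _

theorem tail_mem_siteStable (h : x ∈ siteStable) : tail x ∈ siteStable := fun k => by
  rw [zTransform_tail_apply]
  exact mul_mem zVar_mem_stableRational (sub_mem (h k) (C_mem_stableRational _))

theorem shift_mem_siteStable (h : x ∈ siteStable) (c : ℤ) : shift c x ∈ siteStable :=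
  fun k => h (k + c)

theorem advance₁_mem_siteStable (h : x ∈ siteStable) (β : ℝ) : advance₁ β x ∈ siteStable :=
  sub_mem (tail_mem_siteStable h) (siteStable.smul_mem β h)

theorem advance₂_mem_siteStable (h : x ∈ siteStable) (α κ : ℝ) : advance₂ α κ x ∈ siteStable :=
  sub_mem (tail_mem_siteStable h) (siteStable.smul_mem α (add_mem h
    (siteStable.smul_mem κ (add_mem (shift_mem_siteStable h _) (shift_mem_siteStable h _)))))

end Advance

/-! ### Spatio-temporal convolution -/

/-- The output `∑_{τ ≤ t} ∑ⱼ K_{k-j}(t-τ) yⱼ(τ)` of the causal LTSI system with impulse response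
`K`. -/
def conv (K y : ℤ → ℕ → ℝ) (k : ℤ) (t : ℕ) : ℝ :=
  ∑ τ ∈ Finset.range (t + 1), ∑' j : ℤ, K (k - j) (t - τ) * y j τ

section Conv

variable {E F : ℕ} {x y : ℤ → ℕ → ℝ}

theorem HasExtent.summable_mul (hy : HasExtent E y) (a : ℤ → ℝ) (t : ℕ) :
    Summable fun j => a j * y j t :=
  summable_of_ne_finset_zero fun k hk => by
    rw [hy.eq_zero_of_notMem_Icc hk, Pi.zero_apply, mul_zero]

theorem HasExtent.tsum_mul (hy : HasExtent E y) (a : ℤ → ℝ) (t : ℕ) :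
    ∑' j, a j * y j t = ∑ j ∈ Finset.Icc (-(E : ℤ)) E, a j * y j t :=
  tsum_eq_sum fun k hk => by rw [hy.eq_zero_of_notMem_Icc hk, Pi.zero_apply, mul_zero]

theorem conv_apply_zero (K : ℤ → ℕ → ℝ) (h0 : ∀ k, y k 0 = 0) (k : ℤ) : conv K y k 0 = 0 := by
  simp [conv, h0]

theorem conv_tail (K : ℤ → ℕ → ℝ) (h0 : ∀ k, y k 0 = 0) : conv K (tail y) = tail (conv K y) := by
  ext k t
  change conv K (tail y) k t = conv K y k (t + 1)
  simp [conv, Finset.sum_range_succ' _ (t + 1), h0, tail]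

theorem conv_apply_one (K : ℤ → ℕ → ℝ) (h0 : ∀ k, y k 0 = 0) (h1 : ∀ k, y k 1 = 0) (k : ℤ) :
    conv K y k 1 = 0 :=
  (congrFun (congrFun (conv_tail K h0) k) 0).symm.trans (conv_apply_zero K h1 k)

theorem conv_shift (K y : ℤ → ℕ → ℝ) (c : ℤ) : conv K (shift c y) = shift c (conv K y) := by
  ext k t
  refine Finset.sum_congr rfl fun τ _ => ?_
  rw [← (Equiv.addRight c).tsum_eq fun j => K (k + c - j) (t - τ) * y j τ]
  simp only [Equiv.coe_addRight, add_sub_add_right_eq_sub]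
  rfl

theorem conv_smul (K y : ℤ → ℕ → ℝ) (c : ℝ) : conv K (c • y) = c • conv K y := by
  ext k t
  simp only [conv, Pi.smul_apply, smul_eq_mul, Finset.mul_sum, ← tsum_mul_left, mul_left_comm]

theorem conv_add (K : ℤ → ℕ → ℝ) (hx : HasExtent E x) (hy : HasExtent F y) :
    conv K (x + y) = conv K x + conv K y := by
  ext k t
  simp only [conv, Pi.add_apply, mul_add, ← Finset.sum_add_distrib]
  exact Finset.sum_congr rfl fun τ _ => (hx.summable_mul _ τ).tsum_add (hy.summable_mul _ τ)

theorem conv_sub (K : ℤ → ℕ → ℝ) (hx : HasExtent E x) (hy : HasExtent F y) :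
    conv K (x - y) = conv K x - conv K y := by
  ext k t
  simp only [conv, Pi.sub_apply, mul_sub, ← Finset.sum_sub_distrib]
  exact Finset.sum_congr rfl fun τ _ => (hx.summable_mul _ τ).tsum_sub (hy.summable_mul _ τ)

theorem conv_advance₁ (K : ℤ → ℕ → ℝ) (hy : HasExtent E y) (h0 : ∀ k, y k 0 = 0) (β : ℝ) :
    conv K (advance₁ β y) = advance₁ β (conv K y) := by
  change conv K (tail y - β • y) = tail (conv K y) - β • conv K y
  rw [conv_sub K hy.tail (hy.smul β), conv_tail K h0, conv_smul]

theorem conv_advance₂ (K : ℤ → ℕ → ℝ) (hy : HasExtent E y) (h0 : ∀ k, y k 0 = 0) (α κ : ℝ) :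
    conv K (advance₂ α κ y) = advance₂ α κ (conv K y) := by
  have hσ := (hy.mono E.le_succ).add (hy.neighbours κ)
  change conv K (tail y - α • (y + κ • (shift (-1) y + shift 1 y))) =
    tail (conv K y) - α • (conv K y + κ • (shift (-1) (conv K y) + shift 1 (conv K y)))
  rw [conv_sub K hy.tail (hσ.smul α), conv_smul, conv_add K hy (hy.neighbours κ), conv_smul,
    conv_add K (hy.shift (F := 1) (by norm_num)) (hy.shift (F := 1) (by norm_num)), conv_shift,
    conv_shift, conv_tail K h0]

end Conv

/-! ### Deconvolution -/

/-- The impulse response `r` agrees with the delayed unit impulse `z⁻²` up to time `2`. -/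
structure StartsWithDelayedImpulse (r : ℤ → ℕ → ℝ) : Prop where
  zero : ∀ k, r k 0 = 0
  one : ∀ k, r k 1 = 0
  two : ∀ k, r k 2 = if k = 0 then 1 else 0

/-- The solution `K` of `conv K r = m`, for `r` starting with the delayed unit impulse and `m`
starting with two zeros. -/
def deconv (r m : ℤ → ℕ → ℝ) (k : ℤ) (t : ℕ) : ℝ :=
  m k (t + 2) - ∑ τ : Fin t, ∑' j : ℤ, deconv r m (k - j) (t - 1 - τ) * r j (τ + 3)
  termination_by t
  decreasing_by omega

section Deconv

variable {r m : ℤ → ℕ → ℝ}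

theorem StartsWithDelayedImpulse.conv_add_two (hr : StartsWithDelayedImpulse r) (K : ℤ → ℕ → ℝ)
    (k : ℤ) (t : ℕ) :
    conv K r k (t + 2)
      = K k t + ∑ τ ∈ Finset.range t, ∑' j : ℤ, K (k - j) (t - 1 - τ) * r j (τ + 3) := by
  have hfirst : ∑' j : ℤ, K (k - j) t * r j 2 = K k t := by
    simp only [hr.two, mul_ite, mul_one, mul_zero, tsum_ite_eq, sub_zero]
  have htail : conv K r k (t + 2) = conv K (tail (tail r)) k t := by
    rw [conv_tail K hr.one, conv_tail K hr.zero]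
    rfl
  rw [htail, conv, Finset.sum_range_succ', add_comm]
  refine congrArg₂ (· + ·) hfirst (Finset.sum_congr rfl fun τ _ => tsum_congr fun j => ?_)
  rw [Nat.sub_sub, Nat.add_comm 1 τ]
  rfl

theorem StartsWithDelayedImpulse.conv_left_injective (hr : StartsWithDelayedImpulse r) :
    Function.Injective fun K => conv K r := fun K K' h => by
  suffices ∀ t k, K k t = K' k t from funext₂ fun k t => this t k
  intro t
  induction t using Nat.strong_induction_on with
  | _ t ih =>
    intro k
    have hk : conv K r k (t + 2) = conv K' r k (t + 2) := congrFun (congrFun h k) _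
    rw [hr.conv_add_two, hr.conv_add_two] at hk
    refine add_right_cancel (hk.trans (congrArg _ ?_))
    refine Finset.sum_congr rfl fun τ hτ => tsum_congr fun j => ?_
    rw [ih (t - 1 - τ) (by rw [Finset.mem_range] at hτ; omega)]

theorem deconv_eq (r m : ℤ → ℕ → ℝ) (k : ℤ) (t : ℕ) :
    deconv r m k t = m k (t + 2) -
      ∑ τ ∈ Finset.range t, ∑' j : ℤ, deconv r m (k - j) (t - 1 - τ) * r j (τ + 3) := by
  rw [deconv, Finset.sum_range]

theorem summable_deconv {E F : ℕ} (hr : HasExtent E r) (hm : HasExtent F m) (t : ℕ) :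
    Summable fun k => deconv r m k t := by
  induction t using Nat.strong_induction_on with
  | _ t ih =>
    simp only [deconv_eq r m _ t, hr.tsum_mul]
    refine Summable.sub (by simpa using hm.summable_mul 1 (t + 2)) ?_
    refine summable_sum fun τ hτ => summable_sum fun j _ => Summable.mul_right _ ?_
    exact (Equiv.subRight j).summable_iff.mpr
      (ih (t - 1 - τ) (by rw [Finset.mem_range] at hτ; omega))

theorem StartsWithDelayedImpulse.conv_deconv (hr : StartsWithDelayedImpulse r)
    (hm0 : ∀ k, m k 0 = 0) (hm1 : ∀ k, m k 1 = 0) : conv (deconv r m) r = m := by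
  ext k t
  match t with
  | 0 => rw [conv_apply_zero _ hr.zero, hm0]
  | 1 => rw [conv_apply_one _ hr.zero hr.one, hm1]
  | t + 2 => rw [hr.conv_add_two, deconv_eq, sub_add_cancel]

end Deconv

/-! ### The closed loop -/

theorem impulse_self (c : Dist) : impulse c c = unitImpulse := by
  ext k t
  rcases eq_or_ne k 0 with rfl | hk
  · simp [impulse, unitImpulse, Pi.single_apply]
  · simp [impulse, unitImpulse, hk]

theorem impulse_of_ne {c c' : Dist} (h : c' ≠ c) : impulse c c' = 0 := by
  ext k t
  exact if_neg fun h' => h h'.1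

section Loop

variable {α β κ : ℝ} {K : Controller}

theorem control_eq_conv (w : Dist → ℤ → ℕ → ℝ) :
    control α β κ K w = conv K.ker (measurement α β κ K w) := by
  ext k t
  rw [control, conv, Finset.sum_range]

variable (α β κ K) in
/-- The signals `ρ` satisfy the equations of the closed loop, started at rest, with disturbances
`w`. -/
structure SolvesLoop (w : Dist → ℤ → ℕ → ℝ) (ρ : Signal → ℤ → ℕ → ℝ) : Prop where
  x1_zero : ∀ k, ρ .x1 k 0 = 0
  x2_zero : ∀ k, ρ .x2 k 0 = 0
  x1 : advance₁ β (ρ .x1) = ρ .x2 + w .x1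
  x2 : advance₂ α κ (ρ .x2) = w .x2 + w .u + ρ .u
  y : ρ .y = ρ .x1 + w .y
  u : ρ .u = conv K.ker (ρ .y)

theorem SolvesLoop.state_eq {w : Dist → ℤ → ℕ → ℝ} {ρ : Signal → ℤ → ℕ → ℝ}
    (h : SolvesLoop α β κ K w ρ) (t : ℕ) (k : ℤ) :
    state α β κ K w t k = (ρ .x1 k t, ρ .x2 k t) := by
  induction t using Nat.strong_induction_on generalizing k with
  | _ t ih =>
    match t with
    | 0 => rw [state_zero, h.x1_zero, h.x2_zero]
    | t + 1 =>
      have hu : control α β κ K w k t = ρ .u k t := by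
        rw [control_eq_conv, h.u, h.y]
        refine Finset.sum_congr rfl fun τ hτ => tsum_congr fun j => ?_
        rw [measurement, ih τ (Finset.mem_range.mp hτ)]
        rfl
      have iht := ih t t.lt_succ_self
      rw [state_succ, hu, iht, iht, iht, advance₁_eq_iff.mp h.x1, advance₂_eq_iff.mp h.x2]
      simp only [Pi.add_apply, add_assoc]

theorem SolvesLoop.response_eq {c : Dist} {ρ : Signal → ℤ → ℕ → ℝ}
    (h : SolvesLoop α β κ K (impulse c) ρ) : response α β κ K c = ρ := by
  have hy : measurement α β κ K (impulse c) = ρ .y := by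
    ext k t
    rw [measurement, h.state_eq, h.y]
    rfl
  have hu : control α β κ K (impulse c) = ρ .u := by rw [control_eq_conv, hy, h.u]
  funext s
  cases s
  · exact funext₂ fun k t => congrArg Prod.fst (h.state_eq t k)
  · exact funext₂ fun k t => congrArg Prod.snd (h.state_eq t k)
  · exact hu
  · exact hy

theorem solvesLoop_response (c : Dist) :
    SolvesLoop α β κ K (impulse c) (response α β κ K c) where
  x1_zero k := congrArg Prod.fst (state_zero ..)
  x2_zero k := congrArg Prod.snd (state_zero ..)
  x1 := advance₁_eq_iff.mpr fun k t => by
    simp only [response, state_succ, Pi.add_apply, add_assoc]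
  x2 := advance₂_eq_iff.mpr fun k t => by
    simp only [response, state_succ, Pi.add_apply, add_assoc]
  y := rfl
  u := control_eq_conv _

variable (α β κ) in
/-- The map `(z - σ) (z - β) r - 1`, which is the map from `w^{x,2}` to `u` when `r` is the map
from `w^{x,2}` to `x¹`. -/
def controlMap (r : ℤ → ℕ → ℝ) : ℤ → ℕ → ℝ := advance₂ α κ (advance₁ β r) - unitImpulse

variable (α β κ) in
/-- All closed-loop maps, expressed through the map `r` from `w^{x,2}` to `x¹`. -/
def loopMap (r : ℤ → ℕ → ℝ) : Dist → Signal → ℤ → ℕ → ℝ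
  | .x1, .x1 => advance₂ α κ r
  | .x1, .x2 => controlMap α β κ r
  | .x1, .u => advance₂ α κ (controlMap α β κ r)
  | .x1, .y => advance₂ α κ r
  | .x2, .x1 => r
  | .x2, .x2 => advance₁ β r
  | .x2, .u => controlMap α β κ r
  | .x2, .y => r
  | .u, .x1 => r
  | .u, .x2 => advance₁ β r
  | .u, .u => controlMap α β κ r
  | .u, .y => r
  | .y, .x1 => controlMap α β κ r
  | .y, .x2 => advance₁ β (controlMap α β κ r)
  | .y, .u => advance₂ α κ (advance₁ β (controlMap α β κ r))
  | .y, .y => controlMap α β κ r + unitImpulse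

theorem advance₂_advance₁_eq_controlMap_add (r : ℤ → ℕ → ℝ) :
    advance₂ α κ (advance₁ β r) = controlMap α β κ r + unitImpulse :=
  (sub_add_cancel _ _).symm

theorem conv_loopMap_y {r : ℤ → ℕ → ℝ} {E : ℕ} (hr : HasExtent E r) (h0 : ∀ k, r k 0 = 0)
    (h1 : ∀ k, r k 1 = 0) (hK : conv K.ker r = controlMap α β κ r) (c : Dist) :
    loopMap α β κ r c .u = conv K.ker (loopMap α β κ r c .y) := by
  cases c <;> simp only [loopMap]
  · rw [conv_advance₂ _ hr h0, hK]
  · exact hK.symm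
  · exact hK.symm
  · rw [← advance₂_advance₁_eq_controlMap_add, conv_advance₂ _ (hr.advance₁ β)
      fun k => advance₁_apply_zero β (h0 k) (h1 k), conv_advance₁ _ hr h0, hK]

theorem solvesLoop_loopMap {r : ℤ → ℕ → ℝ} {E : ℕ} (hr : HasExtent E r) (h0 : ∀ k, r k 0 = 0)
    (h1 : ∀ k, r k 1 = 0) (hK : conv K.ker r = controlMap α β κ r) (c : Dist) :
    SolvesLoop α β κ K (impulse c) (loopMap α β κ r c) := by
  have hm0 (k : ℤ) : controlMap α β κ r k 0 = 0 := hK ▸ conv_apply_zero _ h0 k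
  have hm1 (k : ℤ) : controlMap α β κ r k 1 = 0 := hK ▸ conv_apply_one _ h0 h1 k
  constructor
  case x1_zero =>
    intro k
    cases c
    exacts [advance₂_apply_zero α κ h0 (h1 k), h0 k, h0 k, hm0 k]
  case x2_zero =>
    intro k
    cases c
    exacts [hm0 k, advance₁_apply_zero β (h0 k) (h1 k), advance₁_apply_zero β (h0 k) (h1 k),
      advance₁_apply_zero β (hm0 k) (hm1 k)]
  case u => exact conv_loopMap_y hr h0 h1 hK c
  all_goals
    cases c <;> simp [impulse_self, impulse_of_ne, loopMap, ← advance₂_advance₁,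
      advance₂_advance₁_eq_controlMap_add, add_comm]

theorem response_eq_loopMap {r : ℤ → ℕ → ℝ} {E : ℕ} (hr : HasExtent E r) (h0 : ∀ k, r k 0 = 0)
    (h1 : ∀ k, r k 1 = 0) (hK : conv K.ker r = controlMap α β κ r) :
    response α β κ K = loopMap α β κ r :=
  funext fun c => (solvesLoop_loopMap hr h0 h1 hK c).response_eq

theorem controlMap_response :
    controlMap α β κ (response α β κ K .x2 .x1) = response α β κ K .x2 .u := by
  have h := solvesLoop_response (α := α) (β := β) (κ := κ) (K := K) .x2
  rw [controlMap, h.x1, impulse_of_ne (by decide), add_zero, h.x2,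
    impulse_self, impulse_of_ne (by decide), add_zero, add_sub_cancel_left]

theorem conv_response :
    conv K.ker (response α β κ K .x2 .x1) = controlMap α β κ (response α β κ K .x2 .x1) := by
  have h := solvesLoop_response (α := α) (β := β) (κ := κ) (K := K) .x2
  rw [controlMap_response, h.u, h.y, impulse_of_ne (by decide), add_zero]

theorem response_x2_x1_one (k : ℤ) : response α β κ K .x2 .x1 k 1 = 0 := by
  have h := solvesLoop_response (α := α) (β := β) (κ := κ) (K := K) .x2
  rw [advance₁_eq_iff.mp h.x1, h.x1_zero, mul_zero, zero_add, Pi.add_apply, Pi.add_apply,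
    h.x2_zero, impulse_of_ne (by decide), Pi.zero_apply, Pi.zero_apply, add_zero]

theorem response_eq_loopMap_of_hasExtent {E : ℕ} (h : HasExtent E (response α β κ K .x2 .x1)) :
    response α β κ K = loopMap α β κ (response α β κ K .x2 .x1) :=
  response_eq_loopMap h (solvesLoop_response .x2).x1_zero response_x2_x1_one conv_response

end Loop

/-! ### The parametrization by `f` -/

section Parameter

variable {α β κ : ℝ} {K : Controller} {E : ℕ} {r : ℤ → ℕ → ℝ}

variable (α β κ) in
/-- The impulse response of `z⁻² + z⁻³ (σ + β) + z⁻⁴ φ`. -/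
def paramResponse (φ : ℤ → ℕ → ℝ) (k : ℤ) : ℕ → ℝ
  | 0 => 0
  | 1 => 0
  | 2 => if k = 0 then 1 else 0
  | 3 => if k = 0 then α + β else if |k| = 1 then α * κ else 0
  | t + 4 => φ k t

theorem startsWithDelayedImpulse_paramResponse (φ : ℤ → ℕ → ℝ) :
    StartsWithDelayedImpulse (paramResponse α β κ φ) :=
  ⟨fun _ => rfl, fun _ => rfl, fun _ => rfl⟩

theorem controlMap_apply_zero (h0 : ∀ k, r k 0 = 0) (h1 : ∀ k, r k 1 = 0) (k : ℤ) :
    controlMap α β κ r k 0 = r k 2 - if k = 0 then 1 else 0 := by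
  simp only [controlMap, Pi.sub_apply, advance₂_apply, advance₁_apply, h0, h1, unitImpulse,
    Pi.single_apply]
  split_ifs <;> simp

theorem StartsWithDelayedImpulse.controlMap_apply_one (hr : StartsWithDelayedImpulse r) (k : ℤ) :
    controlMap α β κ r k 1
      = r k 3 - if k = 0 then α + β else if |k| = 1 then α * κ else 0 := by
  have hδ : unitImpulse k 1 = 0 := by
    rcases eq_or_ne k 0 with rfl | hk <;> simp [unitImpulse, *]
  simp only [controlMap, Pi.sub_apply, advance₂_apply, advance₁_apply, hr.one, hr.two, hδ]
  rcases eq_or_ne k 0 with rfl | h0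
  · simp
    ring
  by_cases h1 : |k| = 1
  · rcases (abs_eq zero_le_one).mp h1 with rfl | rfl <;> simp
  · have hsub : k - 1 ≠ 0 := fun h => h1 (by rw [sub_eq_zero.mp h, abs_one])
    have hadd : k + 1 ≠ 0 := fun h => h1 (by rw [eq_neg_of_add_eq_zero_left h, abs_neg, abs_one])
    simp [h0, h1, hsub, hadd]

theorem controlMap_paramResponse_zero (φ : ℤ → ℕ → ℝ) (k : ℤ) :
    controlMap α β κ (paramResponse α β κ φ) k 0 = 0 :=
  (controlMap_apply_zero (fun _ => rfl) (fun _ => rfl) k).trans (sub_self _)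

theorem controlMap_paramResponse_one (φ : ℤ → ℕ → ℝ) (k : ℤ) :
    controlMap α β κ (paramResponse α β κ φ) k 1 = 0 :=
  ((startsWithDelayedImpulse_paramResponse φ).controlMap_apply_one k).trans (sub_self _)

theorem startsWithDelayedImpulse_response :
    StartsWithDelayedImpulse (response α β κ K .x2 .x1) := by
  have h0 := (solvesLoop_response (α := α) (β := β) (κ := κ) (K := K) .x2).x1_zero
  refine ⟨h0, response_x2_x1_one, fun k => sub_eq_zero.mp ?_⟩
  rw [← controlMap_apply_zero (α := α) (β := β) (κ := κ) h0 response_x2_x1_one, ← conv_response,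
    conv_apply_zero _ h0]

theorem response_eq_paramResponse :
    response α β κ K .x2 .x1
      = paramResponse α β κ fun k t => response α β κ K .x2 .x1 k (t + 4) := by
  have hr := startsWithDelayedImpulse_response (α := α) (β := β) (κ := κ) (K := K)
  have hcontrol (k : ℤ) : controlMap α β κ (response α β κ K .x2 .x1) k 1 = 0 :=
    conv_response ▸ conv_apply_one _ hr.zero hr.one k
  ext k t
  match t with
  | 0 => exact hr.zero k
  | 1 => exact hr.one k
  | 2 => exact hr.two k
  | 3 => exact sub_eq_zero.mp ((hr.controlMap_apply_one k).symm.trans (hcontrol k))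
  | t + 4 => rfl

theorem zTransform_paramResponse (φ : ℤ → ℕ → ℝ) (k : ℤ) :
    zTransform (paramResponse α β κ φ k)
      = gEntry α β κ k + (zVar ℝ)⁻¹ ^ 4 * zTransform (φ k) := by
  have hz := zVar_ne_zero (𝕜 := ℝ)
  rw [zTransform_eq_add_inv_mul,
    zTransform_eq_add_inv_mul (fun t => paramResponse α β κ φ k (t + 1)),
    zTransform_eq_add_inv_mul (fun t => paramResponse α β κ φ k (t + 1 + 1)),
    zTransform_eq_add_inv_mul (fun t => paramResponse α β κ φ k (t + 1 + 1 + 1))]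
  simp only [paramResponse, map_zero, zero_add, gEntry, band, const]
  split_ifs <;> simp only [map_zero, map_one, map_add] <;> field_simp <;> ring

theorem parameter_eq_zTransform (k : ℤ) :
    parameter α β κ K k = zTransform fun t => response α β κ K .x2 .x1 k (t + 4) := by
  change zVar ℝ ^ 4 * (zTransform (response α β κ K .x2 .x1 k) - gEntry α β κ k) = _
  conv_lhs => rw [response_eq_paramResponse]
  rw [zTransform_paramResponse, add_sub_cancel_left, ← mul_assoc, inv_pow,
    mul_inv_cancel₀ (pow_ne_zero _ zVar_ne_zero), one_mul]

theorem HasExtent.paramResponse {φ : ℤ → ℕ → ℝ} (h : HasExtent E φ) :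
    HasExtent (max E 1) (paramResponse α β κ φ) := fun k hk => funext fun t => by
  push_cast at hk
  have h0 : k ≠ 0 := by
    rintro rfl
    rw [abs_zero] at hk
    omega
  have h1 : |k| ≠ 1 := by omega
  match t with
  | 0 => rfl
  | 1 => rfl
  | 2 => exact if_neg h0
  | 3 => exact (if_neg h0).trans (if_neg h1)
  | t + 4 => exact congrFun (h k (by omega)) t

theorem hasExtent_parameter_iff :
    HasExtent E (parameter α β κ K)
      ↔ HasExtent E fun k t => response α β κ K .x2 .x1 k (t + 4) := by
  refine forall₂_congr fun k _ => ?_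
  rw [parameter_eq_zTransform, ← zTransform_zero]
  exact zTransform_injective.eq_iff

theorem HasExtent.response_of_parameter (h : HasExtent E (parameter α β κ K)) :
    HasExtent (max E 1) (response α β κ K .x2 .x1) := by
  rw [response_eq_paramResponse]
  exact (hasExtent_parameter_iff.mp h).paramResponse

theorem HasExtent.parameter (h : HasExtent E (response α β κ K .x2 .x1)) :
    HasExtent E (parameter α β κ K) :=
  hasExtent_parameter_iff.mpr fun k hk => funext fun t => congrFun (h k hk) (t + 4)

end Parameter

/-! ### Extents and stability of the closed-loop maps -/

section Feasibility

variable {α β κ : ℝ} {K : Controller} {E : ℕ} {r : ℤ → ℕ → ℝ}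

theorem HasExtent.controlMap (hr : HasExtent E r) : HasExtent (E + 1) (controlMap α β κ r) :=
  ((hr.advance₁ β).advance₂ α κ).sub hasExtent_unitImpulse

theorem HasExtent.loopMap_state (hr : HasExtent E r) (c : Dist) :
    HasExtent (E + 1) (loopMap α β κ r c .x1) ∧ HasExtent (E + 1) (loopMap α β κ r c .x2) := by
  have hr' := hr.mono E.le_succ
  cases c
  exacts [⟨hr.advance₂ α κ, hr.controlMap⟩, ⟨hr', hr'.advance₁ β⟩, ⟨hr', hr'.advance₁ β⟩,
    ⟨hr.controlMap, hr.controlMap.advance₁ β⟩]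

theorem HasExtent.loopMap (hr : HasExtent E r) (c : Dist) (s : Signal) :
    HasExtent (E + 2) (loopMap α β κ r c s) := by
  have hle : E + 1 ≤ E + 2 := (E + 1).le_succ
  have hr' := hr.mono (E.le_add_right 2)
  have hm : HasExtent (E + 1) (SpatialSL.controlMap α β κ r) := hr.controlMap
  cases s
  case x1 => exact (hr.loopMap_state c).1.mono hle
  case x2 => exact (hr.loopMap_state c).2.mono hle
  all_goals cases c
  exacts [hm.advance₂ α κ, hm.mono hle, hm.mono hle, (hm.advance₁ β).advance₂ α κ,
    (hr.advance₂ α κ).mono hle, hr', hr', (hm.mono hle).add hasExtent_unitImpulse]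

theorem controlMap_mem_siteStable (hr : r ∈ siteStable) : controlMap α β κ r ∈ siteStable :=
  sub_mem (advance₂_mem_siteStable (advance₁_mem_siteStable hr β) α κ) unitImpulse_mem_siteStable

theorem loopMap_mem_siteStable (hr : r ∈ siteStable) (c : Dist) (s : Signal) :
    loopMap α β κ r c s ∈ siteStable := by
  have hm : controlMap α β κ r ∈ siteStable := controlMap_mem_siteStable hr
  have hx2 : advance₁ β r ∈ siteStable := advance₁_mem_siteStable hr β
  have hy2 : advance₁ β (controlMap α β κ r) ∈ siteStable := advance₁_mem_siteStable hm β
  cases c <;> cases s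
  exacts [advance₂_mem_siteStable hr α κ, hm, advance₂_mem_siteStable hm α κ,
    advance₂_mem_siteStable hr α κ, hr, hx2, hm, hr, hr, hx2, hm, hr, hm, hy2,
    advance₂_mem_siteStable hy2 α κ, add_mem hm unitImpulse_mem_siteStable]

theorem slExtentBounds_of_hasExtent_response (hr : HasExtent E (response α β κ K .x2 .x1)) :
    SLExtentBounds α β κ (E + 1) (E + 2) K := by
  have hloop := response_eq_loopMap_of_hasExtent hr
  have hx (c : Dist) := hr.loopMap_state (α := α) (β := β) (κ := κ) c
  have hu (c : Dist) := hr.loopMap (α := α) (β := β) (κ := κ) c .u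
  simp only [← hloop] at hx hu
  simp only [SLExtentBounds, hasExtent_matrix_iff, Fin.forall_fin_two, Fin.forall_fin_one]
  exact ⟨⟨⟨(hx .x1).1, (hx .x2).1⟩, (hx .x1).2, (hx .x2).2⟩, ⟨(hx .y).1, (hx .y).2⟩,
    ⟨hu .x1, hu .x2⟩, hu .y⟩

theorem SLExtentBounds.mono {a b a' b' : ℕ} (h : SLExtentBounds α β κ a b K) (ha : a ≤ a')
    (hb : b ≤ b') : SLExtentBounds α β κ a' b' K :=
  ⟨h.1.mono ha, h.2.1.mono ha, h.2.2.1.mono hb, h.2.2.2.mono hb⟩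

theorem SLExtentBounds.slFeasible {a b : ℕ} (h : SLExtentBounds α β κ a b K)
    (hK : InternallyStabilizing α β κ K) : SLFeasible α β κ K :=
  ⟨hK, ⟨a, h.1⟩, ⟨b, h.2.2.1⟩, ⟨a, h.2.1⟩, ⟨b, h.2.2.2⟩⟩

theorem slFeasible_iff_exists_slFeasibleAt :
    SLFeasible α β κ K ↔ ∃ E : ℕ, SLFeasibleAt α β κ E K := by
  refine ⟨fun h => ?_, fun ⟨_, h⟩ => h.1⟩
  obtain ⟨E, hE⟩ := h.2.1
  exact ⟨E, h, HasExtent.parameter (hasExtent_matrix_iff.mp hE 0 1)⟩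

theorem SLFeasibleAt.slExtentBounds (h : SLFeasibleAt α β κ E K) :
    SLExtentBounds α β κ (max (E + 1) 2) (max (E + 2) 3) K :=
  (slExtentBounds_of_hasExtent_response h.2.response_of_parameter).mono (by omega) (by omega)

theorem HasExtent.of_advance₂ (hακ : α * κ ≠ 0) (hr : HasExtent (E + 1) r)
    (hadv : HasExtent (E + 1) (SpatialSL.advance₂ α κ r)) : HasExtent E r := by
  have hneighbours {l : ℤ} (hl : ((E + 1 : ℕ) : ℤ) < |l|) (t : ℕ) :
      r (l - 1) t + r (l + 1) t = 0 := by
    have h : SpatialSL.advance₂ α κ r l t = 0 := congrFun (hadv l hl) t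
    rw [advance₂_apply, hr l hl, Pi.zero_apply, Pi.zero_apply, zero_add, zero_sub, ← mul_assoc,
      neg_eq_zero] at h
    exact (mul_eq_zero.mp h).resolve_left hακ
  refine fun k hk => funext fun t => ?_
  rcases lt_abs.mp hk with hpos | hneg
  · have h := hneighbours (l := k + 1) (by rw [lt_abs]; push_cast; omega) t
    rwa [add_sub_cancel_right, hr (k + 1 + 1) (by rw [lt_abs]; push_cast; omega), Pi.zero_apply,
      add_zero] at h
  · have h := hneighbours (l := k - 1) (by rw [lt_abs]; push_cast; omega) t
    rwa [sub_add_cancel, hr (k - 1 - 1) (by rw [lt_abs]; push_cast; omega), Pi.zero_apply,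
      zero_add] at h

theorem slFeasibleAt_iff_slExtentBounds (hE : 1 ≤ E) (hακ : α * κ ≠ 0) :
    SLFeasibleAt α β κ E K ↔
      InternallyStabilizing α β κ K ∧ SLExtentBounds α β κ (E + 1) (E + 2) K := by
  refine ⟨fun h => ⟨h.1.1, h.slExtentBounds.mono (by omega) (by omega)⟩, fun ⟨hK, hb⟩ => ?_⟩
  have hr : HasExtent (E + 1) (response α β κ K .x2 .x1) := hasExtent_matrix_iff.mp hb.1 0 1
  have hr11 : HasExtent (E + 1) (response α β κ K .x1 .x1) := hasExtent_matrix_iff.mp hb.1 0 0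
  rw [response_eq_loopMap_of_hasExtent hr] at hr11
  exact ⟨hb.slFeasible hK, (HasExtent.of_advance₂ hακ hr hr11).parameter⟩

end Feasibility

/-! ### Controllers from parameters -/

section Bijection

variable {α β κ : ℝ} {K : Controller} {E : ℕ} {φ : ℤ → ℕ → ℝ}

theorem band_mem_stableRational {a b c : LaurentSeries ℝ} (ha : a ∈ stableRational ℝ)
    (hb : b ∈ stableRational ℝ) (hc : c ∈ stableRational ℝ) (k : ℤ) :
    band a b c k ∈ stableRational ℝ := by
  unfold band
  split_ifs
  exacts [ha, hb, hc, zero_mem _]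

theorem gEntry_mem_stableRational (k : ℤ) : gEntry α β κ k ∈ stableRational ℝ :=
  mul_mem (pow_mem inv_zVar_mem_stableRational 3) (band_mem_stableRational
    (add_mem (add_mem zVar_mem_stableRational (C_mem_stableRational _)) (C_mem_stableRational _))
    (C_mem_stableRational _) (zero_mem _) k)

theorem paramResponse_mem_siteStable (hφ : φ ∈ siteStable) :
    paramResponse α β κ φ ∈ siteStable := fun k => by
  rw [zTransform_paramResponse]
  exact add_mem (gEntry_mem_stableRational k)
    (mul_mem (pow_mem inv_zVar_mem_stableRational 4) (hφ k))

theorem SLFeasibleAt.parameter_mem_RHinf (hK : SLFeasibleAt α β κ E K) (k : ℤ) :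
    parameter α β κ K k ∈ RHinf ℝ := by
  rw [parameter_eq_zTransform, zTransform_mem_RHinf_iff]
  have hr : response α β κ K .x2 .x1 ∈ siteStable :=
    hK.2.response_of_parameter.isRHinf_iff.mp (hK.1.1 .x2 .x1)
  exact tail_mem_siteStable (tail_mem_siteStable (tail_mem_siteStable (tail_mem_siteStable hr))) k

variable (α β κ) in
theorem parameter_injective : Function.Injective (parameter α β κ) := fun K K' h => by
  have htail (k : ℤ) (t : ℕ) :
      response α β κ K .x2 .x1 k (t + 4) = response α β κ K' .x2 .x1 k (t + 4) := by
    have hk := congrFun h k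
    rw [parameter_eq_zTransform, parameter_eq_zTransform] at hk
    exact congrFun (zTransform_injective hk) t
  have hr : response α β κ K .x2 .x1 = response α β κ K' .x2 .x1 := by
    rw [response_eq_paramResponse, response_eq_paramResponse (K := K')]
    simp only [htail]
  refine Controller.ext (startsWithDelayedImpulse_response (α := α) (β := β) (κ := κ) (K := K)
    |>.conv_left_injective ?_)
  beta_reduce
  rw [conv_response, hr, conv_response]

variable (α β κ) in
/-- The controller with parameter `φ`, recovered from `r¹²` and `m² = K r¹²` by deconvolution. -/
def paramController (hφ : HasExtent E φ) : Controller where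
  ker := deconv (paramResponse α β κ φ) (controlMap α β κ (paramResponse α β κ φ))
  summable := summable_deconv hφ.paramResponse hφ.paramResponse.controlMap

theorem response_paramController (hφ : HasExtent E φ) :
    response α β κ (paramController α β κ hφ) = loopMap α β κ (paramResponse α β κ φ) :=
  response_eq_loopMap hφ.paramResponse (fun _ => rfl) (fun _ => rfl) <|
    (startsWithDelayedImpulse_paramResponse φ).conv_deconv
      (controlMap_paramResponse_zero φ) (controlMap_paramResponse_one φ)

theorem parameter_paramController (hφ : HasExtent E φ) (k : ℤ) :
    parameter α β κ (paramController α β κ hφ) k = zTransform (φ k) := by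
  rw [parameter_eq_zTransform, response_paramController]
  rfl

theorem slFeasibleAt_paramController (hφ : HasExtent E φ) (hs : φ ∈ siteStable) :
    SLFeasibleAt α β κ E (paramController α β κ hφ) := by
  have hresp := response_paramController (α := α) (β := β) (κ := κ) hφ
  have hr : HasExtent (max E 1) (response α β κ (paramController α β κ hφ) .x2 .x1) := by
    rw [hresp]
    exact hφ.paramResponse
  refine ⟨(slExtentBounds_of_hasExtent_response hr).slFeasible fun c s => ?_, ?_⟩
  · rw [hresp]
    exact (hφ.paramResponse.loopMap c s).isRHinf
      (loopMap_mem_siteStable (paramResponse_mem_siteStable hs) c s)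
  · rw [hasExtent_parameter_iff, hresp]
    exact hφ

theorem exists_hasExtent_zTransform_eq {f : Site E → LaurentSeries ℝ} (hf : f ∈ decisionSpace E) :
    ∃ φ : ℤ → ℕ → ℝ, HasExtent E φ ∧ φ ∈ siteStable ∧ ∀ k : Site E, zTransform (φ k) = f k := by
  let φ (k : ℤ) (t : ℕ) : ℝ :=
    if hk : k ∈ Finset.Icc (-(E : ℤ)) E then (f ⟨k, hk⟩).coeff t else 0
  have hext : HasExtent E φ := fun k hk => funext fun t =>
    dif_neg fun h => hk.not_ge (abs_le.mpr (Finset.mem_Icc.mp h))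
  have htransform (k : Site E) : zTransform (φ k) = f k := by
    have hφ : φ k = fun t : ℕ => (f k).coeff t := funext fun t => dif_pos k.2
    rw [hφ, zTransform_coeff (mem_RHinf_iff.mp (hf k)).1]
  refine ⟨φ, hext, fun k => ?_, htransform⟩
  by_cases hk : k ∈ Finset.Icc (-(E : ℤ)) E
  · rw [htransform ⟨k, hk⟩]
    exact (mem_RHinf_iff.mp (hf _)).2
  · rw [hext.eq_zero_of_notMem_Icc hk, zTransform_zero]
    exact zero_mem _

theorem bijOn_parameter :
    Set.BijOn (fun K (k : Site E) => parameter α β κ K k)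
      {K : Controller | SLFeasibleAt α β κ E K} (decisionSpace E) := by
  refine ⟨fun K hK k => hK.parameter_mem_RHinf k, fun K hK K' hK' h => parameter_injective α β κ ?_,
    fun f hf => ?_⟩
  · ext1 k
    by_cases hk : k ∈ Finset.Icc (-(E : ℤ)) E
    · exact congrFun h ⟨k, hk⟩
    · rw [hK.2.eq_zero_of_notMem_Icc hk, hK'.2.eq_zero_of_notMem_Icc hk]
  · obtain ⟨φ, hφ, hs, hfφ⟩ := exists_hasExtent_zTransform_eq hf
    exact ⟨paramController α β κ hφ, slFeasibleAt_paramController hφ hs,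
      funext fun k => (parameter_paramController hφ k).trans (hfφ k)⟩

end Bijection

/-! ### The model-matching cost -/

theorem band_eq (a b c : LaurentSeries ℝ) (k : ℤ) :
    band a b c k = a * (Pi.single 0 1 : ℤ → LaurentSeries ℝ) k
      + b * ((Pi.single 0 1 : ℤ → LaurentSeries ℝ) (k - 1)
        + (Pi.single 0 1 : ℤ → LaurentSeries ℝ) (k + 1))
      + c * ((Pi.single 0 1 : ℤ → LaurentSeries ℝ) (k - 2)
        + (Pi.single 0 1 : ℤ → LaurentSeries ℝ) (k + 2)) := by
  simp only [band, Pi.single_apply, abs_eq (zero_le_one (α := ℤ)), abs_eq (zero_le_two (α := ℤ))]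
  split_ifs <;> first | omega | simp

section Toeplitz

variable {E : ℕ} {x : ℤ → LaurentSeries ℝ}

theorem HasExtent.sum_single_mul (hx : HasExtent E x) (k : ℤ) :
    ∑ j : Site E, (Pi.single 0 1 : ℤ → LaurentSeries ℝ) (k - j) * x j = x k := by
  simp only [Pi.single_apply, sub_eq_zero, ite_mul, one_mul, zero_mul]
  rw [Finset.sum_coe_sort (Finset.Icc (-(E : ℤ)) E) fun j => if k = j then x j else 0,
    Finset.sum_ite_eq]
  exact ite_eq_left_iff.mpr fun hk => (hx.eq_zero_of_notMem_Icc hk).symm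

theorem HasExtent.sum_band_mul (hx : HasExtent E x) (a b c : LaurentSeries ℝ) (k : ℤ) :
    ∑ j : Site E, band a b c (k - j) * x j
      = a * x k + b * (x (k - 1) + x (k + 1)) + c * (x (k - 2) + x (k + 2)) := by
  have hsub (c : ℤ) (j : Site E) : k - j - c = k - c - j := sub_right_comm k _ c
  have hadd (c : ℤ) (j : Site E) : k - j + c = k + c - j := sub_add_eq_add_sub k _ c
  simp only [band_eq, hsub, hadd, add_mul, mul_assoc, Finset.sum_add_distrib, ← Finset.mul_sum,
    hx.sum_single_mul]

theorem HasExtent.Smat_mulVec (hx : HasExtent E x) (k : Site (E + 1)) :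
    (Smat E).mulVec (fun j => x j) k = (zVar ℝ)⁻¹ ^ 4 * x k := by
  rw [← hx.sum_single_mul, Finset.mul_sum, Matrix.mulVec, dotProduct]
  refine Finset.sum_congr rfl fun j _ => ?_
  rw [Smat, Matrix.of_apply, Pi.single_apply, ← mul_assoc, mul_ite, mul_one, mul_zero]
  simp only [sub_eq_zero]

end Toeplitz

section ColumnNorm

theorem tsum_sq_coeff_zTransform (g : ℕ → ℝ) :
    ∑' t : ℤ, ENNReal.ofReal ((zTransform g).coeff t ^ 2) = ∑' t : ℕ, ENNReal.ofReal (g t ^ 2) := by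
  rw [← (Nat.cast_injective (R := ℤ)).tsum_eq]
  · simp only [coeff_zTransform]
  · refine Function.support_subset_iff'.mpr fun t ht => ?_
    have hneg : t < 0 := not_le.mp fun h => ht ⟨t.toNat, Int.toNat_of_nonneg h⟩
    rw [coeff_zTransform_of_neg g hneg, zero_pow two_ne_zero, ENNReal.ofReal_zero]

theorem HasExtent.columnNormSq_zTransform {E : ℕ} {x : ℤ → ℕ → ℝ} (hx : HasExtent E x) :
    columnNormSq (fun k : Site E => zTransform (x k))
      = ∑' (k : ℤ) (t : ℕ), ENNReal.ofReal (x k t ^ 2) := by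
  simp only [columnNormSq, tsum_sq_coeff_zTransform]
  rw [Finset.sum_coe_sort (Finset.Icc (-(E : ℤ)) E)
    fun k => ∑' t : ℕ, ENNReal.ofReal (x k t ^ 2)]
  refine (tsum_eq_sum fun k hk => ?_).symm
  simp [hx.eq_zero_of_notMem_Icc hk]

theorem systemNormSq_eq_sum {m n : Type*} [Fintype m] [Fintype n] (G : ℤ → ℕ → Matrix m n ℝ) :
    systemNormSq G = ∑ i, ∑ j, ∑' (k : ℤ) (t : ℕ), ENNReal.ofReal (G k t i j ^ 2) := by
  have htrace (A : Matrix m n ℝ) :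
      ENNReal.ofReal (A.transpose * A).trace = ∑ i, ∑ j, ENNReal.ofReal (A i j ^ 2) := by
    simp only [Matrix.trace, Matrix.diag, Matrix.mul_apply, Matrix.transpose_apply, ← sq]
    rw [Finset.sum_comm, ENNReal.ofReal_sum_of_nonneg fun i _ => by positivity]
    exact Finset.sum_congr rfl fun i _ =>
      ENNReal.ofReal_sum_of_nonneg fun j _ => sq_nonneg (A i j)
  simp only [systemNormSq, htrace, Summable.tsum_finsetSum fun _ _ => ENNReal.summable]

theorem systemNorm_sq {m n : Type*} [Fintype m] [Fintype n] (G : ℤ → ℕ → Matrix m n ℝ) :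
    systemNorm G ^ 2 = systemNormSq G := by
  rw [systemNorm, ← ENNReal.rpow_natCast, ← ENNReal.rpow_mul]
  norm_num

end ColumnNorm

section Cost

variable {α β κ : ℝ} {K : Controller} {E : ℕ} {r φ : ℤ → ℕ → ℝ}

variable (α β κ) in
/-- The closed-loop maps that enter the cost, expressed through `r = r¹²` and
`controlMap α β κ r = m²`. -/
def costResponse (r : ℤ → ℕ → ℝ) : CostMap → ℤ → ℕ → ℝ
  | .n1 => controlMap α β κ r
  | .r12 => r
  | .n2 => advance₁ β (controlMap α β κ r)
  | .r22 => advance₁ β r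
  | .l => advance₂ α κ (advance₁ β (controlMap α β κ r))
  | .m2 => controlMap α β κ r

theorem HasExtent.costResponse (hr : HasExtent (E + 1) r) (q : CostMap) :
    HasExtent (E + q.offset) (costResponse α β κ r q) := by
  have hm : HasExtent (E + 2) (SpatialSL.controlMap α β κ r) := hr.controlMap
  cases q
  exacts [hm, hr, hm.advance₁ β, hr.advance₁ β, (hm.advance₁ β).advance₂ α κ, hm]

theorem zTransform_unitImpulse (k : ℤ) :
    zTransform (unitImpulse k) = (Pi.single 0 1 : ℤ → LaurentSeries ℝ) k := by
  rcases eq_or_ne k 0 with rfl | hk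
  · simp [unitImpulse, zTransform_single]
  · simpa [unitImpulse, hk] using zTransform_zero

theorem zTransform_controlMap (h0 : ∀ k, r k 0 = 0) (h1 : ∀ k, r k 1 = 0) (k : ℤ) :
    zTransform (controlMap α β κ r k) = (zVar ℝ - const β) * ((zVar ℝ - const α) *
      zTransform (r k) + -const (α * κ) * (zTransform (r (k - 1)) + zTransform (r (k + 1))))
      - (Pi.single 0 1 : ℤ → LaurentSeries ℝ) k := by
  rw [controlMap, Pi.sub_apply, zTransform_sub, zTransform_unitImpulse,
    zTransform_advance₂ α κ (advance₁_apply_zero β (h0 k) (h1 k))]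
  simp only [zTransform_advance₁ β (h0 _)]
  ring

theorem zTransform_costResponse (hr : HasExtent E r) (h0 : ∀ k, r k 0 = 0) (h1 : ∀ k, r k 1 = 0)
    (hm0 : ∀ k, controlMap α β κ r k 0 = 0) (hm1 : ∀ k, controlMap α β κ r k 1 = 0)
    (q : CostMap) (k : ℤ) :
    zTransform (costResponse α β κ r q k)
      = ∑ j : Site E, Vdiag α β κ q (k - j) * zTransform (r j) + hEntry α β κ q k := by
  have hx : HasExtent E fun j => zTransform (r j) := hr.map zTransform_zero
  have hm := zTransform_controlMap (α := α) (β := β) (κ := κ) h0 h1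
  have hone : k - 1 - 1 = k - 2 ∧ k + 1 + 1 = k + 2 := by omega
  cases q <;> simp only [costResponse, Vdiag, hEntry, mul_assoc, ← Finset.mul_sum,
    hx.sum_band_mul]
  case r12 => ring
  case r22 =>
    rw [zTransform_advance₁ β (h0 k)]
    ring
  case l =>
    rw [zTransform_advance₂ α κ (advance₁_apply_zero β (hm0 k) (hm1 k))]
    simp only [zTransform_advance₁ β (hm0 _), hm, band_eq, sub_add_cancel, add_sub_cancel_right,
      hone]
    ring
  case n2 =>
    rw [zTransform_advance₁ β (hm0 k), hm, band_eq]
    ring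
  all_goals
    rw [hm, band_eq]
    ring

variable (α β κ E) in
theorem mulVec_VSL_add_hSL (f : Site E → LaurentSeries ℝ) :
    (VSL α β κ E).mulVec f + hSL α β κ E
      = (Vstack α β κ E).mulVec ((Smat E).mulVec f + gvec α β κ E) + hstack α β κ E := by
  rw [VSL, hSL, ← Matrix.mulVec_mulVec, Matrix.mulVec_add, add_assoc]

theorem mulVec_VSL_add_hSL_zTransform (hφ : HasExtent E φ) (i : Row E) :
    ((VSL α β κ E).mulVec (fun k => zTransform (φ k)) + hSL α β κ E) i
      = zTransform (costResponse α β κ (paramResponse α β κ φ) i.1 i.2) := by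
  have hr : HasExtent (E + 1) (paramResponse α β κ φ) := hφ.paramResponse.mono (by omega)
  have hx : HasExtent E fun j => zTransform (φ j) := hφ.map zTransform_zero
  have hSf : (Smat E).mulVec (fun k => zTransform (φ k)) + gvec α β κ E
      = fun k : Site (E + 1) => zTransform (paramResponse α β κ φ k) := by
    ext1 k
    rw [Pi.add_apply, hx.Smat_mulVec, gvec, zTransform_paramResponse, add_comm]
  rw [mulVec_VSL_add_hSL, hSf, zTransform_costResponse hr (fun _ => rfl) (fun _ => rfl)
    (controlMap_paramResponse_zero φ) (controlMap_paramResponse_one φ)]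
  rfl

theorem HasExtent.modelCost_zTransform (hφ : HasExtent E φ) :
    modelCost α β κ E (fun k => zTransform (φ k))
      = ∑ q : CostMap, ∑' (k : ℤ) (t : ℕ),
          ENNReal.ofReal (SpatialSL.costResponse α β κ (SpatialSL.paramResponse α β κ φ) q k t ^ 2)
      := by
  have hr : HasExtent (E + 1) (SpatialSL.paramResponse α β κ φ) := hφ.paramResponse.mono (by omega)
  rw [modelCost, columnNormSq, Fintype.sum_sigma]
  simp only [mulVec_VSL_add_hSL_zTransform hφ]
  exact Finset.sum_congr rfl fun q _ => (hr.costResponse q).columnNormSq_zTransform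

theorem HasExtent.systemNormSq_closedLoop (hr : HasExtent E (response α β κ K .x2 .x1)) :
    systemNormSq (closedLoop α β κ K)
      = ∑ q : CostMap, ∑' (k : ℤ) (t : ℕ),
          ENNReal.ofReal (SpatialSL.costResponse α β κ (response α β κ K .x2 .x1) q k t ^ 2) := by
  have huniv : (Finset.univ : Finset CostMap) = {.n1, .r12, .n2, .r22, .l, .m2} := rfl
  rw [systemNormSq_eq_sum, huniv]
  have hloop (c : Dist) := congrFun (response_eq_loopMap_of_hasExtent hr) c
  simp [Fin.sum_univ_succ, closedLoop, hloop .y, hloop .u, SpatialSL.loopMap,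
    SpatialSL.costResponse]
  ring

theorem SLFeasibleAt.systemNorm_sq_eq (hK : SLFeasibleAt α β κ E K) :
    systemNorm (closedLoop α β κ K) ^ 2
      = modelCost α β κ E (fun k => parameter α β κ K k) := by
  simp only [systemNorm_sq, hK.2.response_of_parameter.systemNormSq_closedLoop,
    parameter_eq_zTransform, (hasExtent_parameter_iff.mp hK.2).modelCost_zTransform,
    ← response_eq_paramResponse]

end Cost

section OptimalValue

variable {α β κ : ℝ}

theorem iInf_sq {ι : Sort*} (g : ι → ℝ≥0∞) : (⨅ i, g i) ^ 2 = ⨅ i, g i ^ 2 := by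
  have h := (ENNReal.orderIsoRpow 2 two_pos).map_iInf g
  simpa only [ENNReal.orderIsoRpow_apply, ENNReal.rpow_two] using h

theorem iInf_slFeasibleAt_systemNorm_sq (E : ℕ) :
    (⨅ (K : Controller) (_ : SLFeasibleAt α β κ E K), systemNorm (closedLoop α β κ K)) ^ 2
      = ⨅ (f : Site E → LaurentSeries ℝ) (_ : f ∈ decisionSpace E), modelCost α β κ E f := by
  simp only [iInf_sq]
  rw [← (bijOn_parameter (α := α) (β := β) (κ := κ)).image_eq, iInf_image]
  exact biInf_congr fun K hK => SLFeasibleAt.systemNorm_sq_eq hK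

theorem iInf_slFeasible_systemNorm_sq :
    (⨅ (K : Controller) (_ : SLFeasible α β κ K), systemNorm (closedLoop α β κ K)) ^ 2
      = ⨅ (E : ℕ) (f : Site E → LaurentSeries ℝ) (_ : f ∈ decisionSpace E),
          modelCost α β κ E f := by
  simp only [← iInf_slFeasibleAt_systemNorm_sq, ← iInf_sq, slFeasible_iff_exists_slFeasibleAt,
    iInf_exists]
  rw [iInf_comm]

end OptimalValue

/-! ### Finiteness and convexity -/

section Convexity

theorem columnNormSq_ne_top {ι : Type*} [Fintype ι] {v : ι → LaurentSeries ℝ}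
    (hv : ∀ i, v i ∈ stableRational ℝ) : columnNormSq v ≠ ⊤ :=
  ENNReal.sum_ne_top.mpr fun i _ => (summable_sq_coeff (hv i)).tsum_ofReal_ne_top

theorem columnNormSq_smul_add_smul_le {ι : Type*} [Fintype ι] (v w : ι → LaurentSeries ℝ)
    {a b : ℝ} (ha : 0 ≤ a) (hb : 0 ≤ b) (hab : a + b = 1) :
    columnNormSq (a • v + b • w)
      ≤ ENNReal.ofReal a * columnNormSq v + ENNReal.ofReal b * columnNormSq w := by
  simp only [columnNormSq, Finset.mul_sum, ← Finset.sum_add_distrib, ← ENNReal.tsum_mul_left,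
    ← ENNReal.tsum_add]
  refine Finset.sum_le_sum fun i _ => ENNReal.tsum_le_tsum fun t => ?_
  rw [← ENNReal.ofReal_mul ha, ← ENNReal.ofReal_mul hb,
    ← ENNReal.ofReal_add (by positivity) (by positivity)]
  exact ENNReal.ofReal_le_ofReal <| (even_two.convexOn_pow (𝕜 := ℝ)).2 (Set.mem_univ _)
    (Set.mem_univ _) ha hb hab

theorem convexOn_toReal_columnNormSq {ι : Type*} [Fintype ι] :
    ConvexOn ℝ {v : ι → LaurentSeries ℝ | columnNormSq v ≠ ⊤} fun v => (columnNormSq v).toReal := by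
  have hfinite {v w : ι → LaurentSeries ℝ} (hv : columnNormSq v ≠ ⊤) (hw : columnNormSq w ≠ ⊤)
      (a b : ℝ) : ENNReal.ofReal a * columnNormSq v + ENNReal.ofReal b * columnNormSq w ≠ ⊤ :=
    ENNReal.add_ne_top.mpr
      ⟨ENNReal.mul_ne_top ENNReal.ofReal_ne_top hv, ENNReal.mul_ne_top ENNReal.ofReal_ne_top hw⟩
  refine ⟨fun v hv w hw a b ha hb hab =>
    ne_top_of_le_ne_top (hfinite hv hw a b) (columnNormSq_smul_add_smul_le v w ha hb hab),
    fun v hv w hw a b ha hb hab => ?_⟩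
  have hle := ENNReal.toReal_mono (hfinite hv hw a b)
    (columnNormSq_smul_add_smul_le v w ha hb hab)
  have hsum := hfinite hv hw a b
  rwa [ENNReal.toReal_add (ENNReal.add_ne_top.mp hsum).1 (ENNReal.add_ne_top.mp hsum).2,
    ENNReal.toReal_mul, ENNReal.toReal_mul, ENNReal.toReal_ofReal ha,
    ENNReal.toReal_ofReal hb] at hle

variable {α β κ : ℝ} {E : ℕ}

theorem Vdiag_mem_stableRational (q : CostMap) (d : ℤ) : Vdiag α β κ q d ∈ stableRational ℝ := by
  have hC (a : ℝ) : const a ∈ stableRational ℝ := C_mem_stableRational a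
  have hz (a : ℝ) : zVar ℝ - const a ∈ stableRational ℝ := sub_mem zVar_mem_stableRational (hC a)
  have htwo : (2 : LaurentSeries ℝ) ∈ stableRational ℝ := ofNat_mem _ 2
  have hT := band_mem_stableRational (hz α) (neg_mem (hC (α * κ))) (zero_mem _) d
  have hI := band_mem_stableRational (one_mem (stableRational ℝ)) (zero_mem _) (zero_mem _) d
  have hQ := band_mem_stableRational
    (add_mem (pow_mem (hz α) 2) (mul_mem htwo (pow_mem (hC (α * κ)) 2)))
    (neg_mem (mul_mem (mul_mem htwo (hC (α * κ))) (hz α))) (pow_mem (hC (α * κ)) 2) d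
  cases q
  exacts [mul_mem (hz β) hT, hI, mul_mem (pow_mem (hz β) 2) hT, mul_mem (hz β) hI,
    mul_mem (pow_mem (hz β) 2) hQ, mul_mem (hz β) hT]

theorem hEntry_mem_stableRational (q : CostMap) (k : ℤ) :
    hEntry α β κ q k ∈ stableRational ℝ := by
  have hC (a : ℝ) : const a ∈ stableRational ℝ := C_mem_stableRational a
  have hz : zVar ℝ - const β ∈ stableRational ℝ := sub_mem zVar_mem_stableRational (hC β)
  have hI := band_mem_stableRational (neg_mem (one_mem (stableRational ℝ))) (zero_mem _)
    (zero_mem _) k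
  have hT := band_mem_stableRational (sub_mem (hC α) zVar_mem_stableRational) (hC (α * κ))
    (zero_mem _) k
  cases q
  exacts [hI, zero_mem _, mul_mem hz hI, zero_mem _, mul_mem hz hT, hI]

theorem Smat_mem_stableRational (i : Site (E + 1)) (j : Site E) :
    Smat E i j ∈ stableRational ℝ := by
  rw [Smat, Matrix.of_apply]
  split_ifs
  exacts [pow_mem inv_zVar_mem_stableRational 4, zero_mem _]

theorem mulVec_mem_stableRational {m n : Type*} [Fintype n] {A : Matrix m n (LaurentSeries ℝ)}
    (hA : ∀ i j, A i j ∈ stableRational ℝ) {f : n → LaurentSeries ℝ}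
    (hf : ∀ j, f j ∈ stableRational ℝ) (i : m) : A.mulVec f i ∈ stableRational ℝ :=
  sum_mem fun j _ => mul_mem (hA i j) (hf j)

theorem modelCost_ne_top {f : Site E → LaurentSeries ℝ} (hf : f ∈ decisionSpace E) :
    modelCost α β κ E f ≠ ⊤ := by
  have hSf := mulVec_mem_stableRational Smat_mem_stableRational fun k => (mem_RHinf_iff.mp (hf k)).2
  rw [modelCost, mulVec_VSL_add_hSL]
  exact columnNormSq_ne_top fun i => add_mem
    (mulVec_mem_stableRational (fun _ _ => Vdiag_mem_stableRational _ _)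
      (fun k => add_mem (hSf k) (gEntry_mem_stableRational _)) i)
    (hEntry_mem_stableRational _ _)

theorem convex_RHinf : Convex ℝ (RHinf ℝ) := fun F hF G hG a b _ _ _ => by
  rw [mem_RHinf_iff] at hF hG ⊢
  refine ⟨add_mem ((causal ℝ).smul_mem a hF.1) ((causal ℝ).smul_mem b hG.1), ?_⟩
  rw [← HahnSeries.C_mul_eq_smul, ← HahnSeries.C_mul_eq_smul]
  exact add_mem (mul_mem (C_mem_stableRational a) hF.2) (mul_mem (C_mem_stableRational b) hG.2)

variable (E) in
theorem convex_decisionSpace : Convex ℝ (decisionSpace E) := by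
  have h : decisionSpace E = Set.univ.pi fun _ => RHinf ℝ := by
    simp only [Set.pi, Set.mem_univ, true_imp_iff, decisionSpace]
  rw [h]
  exact convex_pi fun _ _ => convex_RHinf

theorem mulVec_smul_add_smul_add {m n : Type*} [Fintype n] (A : Matrix m n (LaurentSeries ℝ))
    (c : m → LaurentSeries ℝ) (v w : n → LaurentSeries ℝ) {a b : ℝ} (hab : a + b = 1) :
    A.mulVec (a • v + b • w) + c = a • (A.mulVec v + c) + b • (A.mulVec w + c) := by
  have hsmul (s : ℝ) (u : n → LaurentSeries ℝ) : A.mulVec (s • u) = s • A.mulVec u := by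
    have hC : s • u = (HahnSeries.C s : LaurentSeries ℝ) • u :=
      funext fun _ => HahnSeries.C_mul_eq_smul.symm
    rw [hC, Matrix.mulVec_smul]
    exact funext fun _ => HahnSeries.C_mul_eq_smul
  rw [Matrix.mulVec_add, hsmul, hsmul, eq_sub_of_add_eq' hab]
  module

variable (E) in
theorem convexOn_toReal_modelCost :
    ConvexOn ℝ (decisionSpace E) fun f => (modelCost α β κ E f).toReal := by
  refine ⟨convex_decisionSpace E, fun f hf g hg a b ha hb hab => ?_⟩
  simp only [modelCost, mulVec_smul_add_smul_add _ _ f g hab]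
  exact convexOn_toReal_columnNormSq.2 (modelCost_ne_top hf) (modelCost_ne_top hg) ha hb hab

end Convexity

end SpatialSL

end

open SpatialSL in
theorem mainTheorem1 (α β κ : ℝ) :
    -- feasibility means feasibility at some finite extent `E` of the parameter
    (∀ K : Controller, SLFeasible α β κ K ↔ ∃ E : ℕ, SLFeasibleAt α β κ E K) ∧
    -- the optimal values agree
    ((⨅ (K : Controller) (_ : SLFeasible α β κ K), systemNorm (closedLoop α β κ K)) ^ 2
      = ⨅ (E : ℕ) (f : Site E → LaurentSeries ℝ) (_ : f ∈ decisionSpace E),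
          modelCost α β κ E f) ∧
    ∀ E : ℕ,
      -- controllers and decision variables correspond one to one, with equal cost
      Set.BijOn (fun K (k : Site E) => parameter α β κ K k)
        {K : Controller | SLFeasibleAt α β κ E K} (decisionSpace E) ∧
      (∀ K : Controller, SLFeasibleAt α β κ E K →
        systemNorm (closedLoop α β κ K) ^ 2
          = modelCost α β κ E (fun k : Site E => parameter α β κ K k)) ∧
      ((⨅ (K : Controller) (_ : SLFeasibleAt α β κ E K), systemNorm (closedLoop α β κ K)) ^ 2
        = ⨅ (f : Site E → LaurentSeries ℝ) (_ : f ∈ decisionSpace E), modelCost α β κ E f) ∧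
      -- the extents of the closed-loop maps
      (∀ K : Controller, SLFeasibleAt α β κ E K →
        SLExtentBounds α β κ (max (E + 1) 2) (max (E + 2) 3) K) ∧
      (1 ≤ E → α * κ ≠ 0 → ∀ K : Controller,
        (SLFeasibleAt α β κ E K ↔
          InternallyStabilizing α β κ K ∧ SLExtentBounds α β κ (E + 1) (E + 2) K)) ∧
      -- the model-matching problem is finite and convex
      (∀ f ∈ decisionSpace E, modelCost α β κ E f ≠ ⊤) ∧
      ConvexOn ℝ (decisionSpace E) (fun f => (modelCost α β κ E f).toReal) := by
  refine ⟨fun _ => slFeasible_iff_exists_slFeasibleAt, iInf_slFeasible_systemNorm_sq, fun E =>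
    ⟨bijOn_parameter, fun _ hK => hK.systemNorm_sq_eq, iInf_slFeasibleAt_systemNorm_sq E,
      fun _ hK => hK.slExtentBounds, fun hE hακ _ => slFeasibleAt_iff_slExtentBounds hE hακ,
      fun _ hf => modelCost_ne_top hf, convexOn_toReal_modelCost E⟩⟩
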